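/- Let $n\ge 2$, let $F_n$ be the free group of rank $n$ and let $\partial F_n$ be its Gromov boundary with the Cantor topology. The space of lines $\mathcal B$ is the quotient of $\partial F_n\times\partial F_n-\Delta$ ($\Delta$ the diagonal) by the interchange of the two factors and by the diagonal action of $F_n$; its quotient topology is called the weak topology. A pair $(\xi,\eta)$ that projects to $\ell\in\mathcal B$ is a lift of $\ell$. For subgroups $A\le H$ of $F_n$, $A$ is a free factor of $H$ if $H=A*C$ for some subgroup $C$; it is proper if $A\neq H$. A free factor system is a finite set $\mathcal A=\{[A_1],\dots,[A_k]\}$ of conjugacy classes of nontrivial finite rank subgroups of $F_n$ for which there is a free factorization $F_n=A_1*\cdots*A_k*B$, with $B$ possibly trivial. One writes $\mathcal A\sqsubset\mathcal A'$ if each subgroup $A$ with $[A]\in\mathcal A$ is a free factor of some subgroup $A'$ with $[A']\in\mathcal A'$; the meet of a collection of free factor systems is the greatest free factor system that is $\sqsubset$ every member of the collection. A set $\mathcal A$ of conjugacy classes of subgroups carries a line $\ell$ if there are $[A]\in\mathcal A$ and a lift $(\xi,\eta)$ of $\ell$ with $\xi,\eta\in\partial A$, where $\partial A\subset\partial F_n$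 is the set of accumulation points of $A$. A set $B\subset\mathcal B$ is filling if its free factor support, the meet of all free factor systems that carry every line of $B$, is $\{[F_n]\}$. Proposition. Let $B_1,B_2\subset\mathcal B$ be filling sets of lines whose weak closures satisfy $\mathrm{cl}(B_1)\cap \mathrm{cl}(B_2)=\emptyset$. Then there exist weak neighborhoods $U(b)\subset\mathcal B$ of $b$, one for each $b\in B_1\cup B_2$, such that for each proper free factor $F$ of $F_n$ there exists $b_F\in B_1\cup B_2$ such that $\{[F]\}$ does not carry any line in $U(b_F)$. -/

import Mathlib

namespace FreeLines

/-! ### The boundary of the free group of rank `n` -/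

/-- The letters `E_i` (as `(i, true)`) and their inverses (as `(i, false)`), with the convention of
`FreeGroup.toWord`. -/
abbrev Letter (n : ℕ) : Type := Fin n × Bool

/-- The inverse letter. -/
def Letter.inv {n : ℕ} (s : Letter n) : Letter n := (s.1, !s.2)

theorem Letter.inv_inv {n : ℕ} (s : Letter n) : s.inv.inv = s := by
  simp [Letter.inv]

/-- The boundary `∂F_n`: infinite reduced words in the letters, that is, the rays from the base
vertex of the universal cover of the rose, that is, the ends of that tree. As a subtype of a
product of finite discrete spaces it carries the usual Cantor topology. -/
abbrev Boundary (n : ℕ) : Type :=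
  {w : ℕ → Letter n // ∀ i, w (i + 1) ≠ (w i).inv}

/-- Left multiplication of an infinite reduced word by one letter, followed by reduction. -/
def letterMul {n : ℕ} (s : Letter n) (w : Boundary n) : Boundary n :=
  if h : w.1 0 = s.inv then
    ⟨fun i => w.1 (i + 1), fun i => w.2 (i + 1)⟩
  else
    ⟨fun i => Nat.casesOn i s w.1, fun i => by
      cases i with
      | zero => exact h
      | succ j => exact w.2 j⟩

theorem letterMul_inv {n : ℕ} (s : Letter n) (w : Boundary n) :
    letterMul s.inv (letterMul s w) = w := by
  by_cases h : w.1 0 = s.inv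
  · have h1 : w.1 1 ≠ s := by
      have := w.2 0
      rwa [h, Letter.inv_inv] at this
    apply Subtype.ext
    funext i
    cases i with
    | zero => simp [letterMul, h, Letter.inv_inv, h1]
    | succ j => simp [letterMul, h, Letter.inv_inv, h1]
  · apply Subtype.ext
    funext i
    simp [letterMul, h, Letter.inv_inv]

/-- Multiplication by the `x`-th generator as a permutation of the boundary. -/
def generatorPerm {n : ℕ} (x : Fin n) : Equiv.Perm (Boundary n) where
  toFun := letterMul (x, true)
  invFun := letterMul (x, false)
  left_inv w := letterMul_inv (x, true) w
  right_inv w := letterMul_inv (x, false) w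

/-- The action of `F_n` on `∂F_n`, extending left multiplication. -/
instance boundaryAction (n : ℕ) : MulAction (FreeGroup (Fin n)) (Boundary n) :=
  MulAction.compHom (Boundary n) (FreeGroup.lift (generatorPerm (n := n)))

/-- The boundary `∂A ⊆ ∂F_n` of a subgroup: the accumulation points in `∂F_n` of the orbit of the
base vertex, so `ξ ∈ ∂A` iff every finite prefix of `ξ` is a prefix of some element of `A`. -/
def boundaryOf {n : ℕ} (A : Subgroup (FreeGroup (Fin n))) : Set (Boundary n) :=
  {ξ | ∀ m : ℕ, ∃ a ∈ A, List.ofFn (fun i : Fin m => ξ.1 i) <+: a.toWord}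

/-! ### Lines and the weak topology -/

/-- Ordered pairs of distinct boundary points, `∂F_n × ∂F_n - Δ`, with the subspace topology. -/
abbrev EndpointPair (n : ℕ) : Type := {p : Boundary n × Boundary n // p.1 ≠ p.2}

/-- The orbit relation of the commuting actions of `F_n` (diagonal) and of `ℤ/2` (interchange of
the two factors) on `∂F_n × ∂F_n - Δ`. -/
def lineSetoid (n : ℕ) : Setoid (EndpointPair n) where
  r p q := ∃ g : FreeGroup (Fin n), g • p.1 = q.1 ∨ g • p.1 = q.1.swap
  iseqv :=
    { refl := fun p => ⟨1, Or.inl (one_smul _ _)⟩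
      symm := by
        rintro p q ⟨g, h | h⟩
        · exact ⟨g⁻¹, Or.inl (by rw [← h, inv_smul_smul])⟩
        · refine ⟨g⁻¹, Or.inr ?_⟩
          have h' : q.1 = g • p.1.swap := by
            rw [← Prod.swap_swap q.1, ← h]; rfl
          rw [h', inv_smul_smul]
      trans := by
        rintro p q r ⟨g, h⟩ ⟨k, h'⟩
        refine ⟨k * g, ?_⟩
        have hs : ∀ x : Boundary n × Boundary n, k • x.swap = (k • x).swap := fun _ => rfl
        rcases h with h | h <;> rcases h' with h' | h' <;>
          simp [mul_smul, h, h', hs] }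

/-- The space `𝓑` of lines of `F_n`: the quotient of `∂F_n × ∂F_n - Δ` by `ℤ/2` and `F_n`. -/
def Line (n : ℕ) : Type := Quotient (lineSetoid n)

/-- The weak topology: the quotient topology on the space of lines. -/
instance lineTopology (n : ℕ) : TopologicalSpace (Line n) :=
  inferInstanceAs (TopologicalSpace (Quotient (lineSetoid n)))

/-- The line with a given lift. -/
def Line.mk {n : ℕ} (p : EndpointPair n) : Line n := Quotient.mk (lineSetoid n) p

/-! ### Free factorizations and subgroup systems -/

section Systems

open scoped Pointwise

variable {G : Type*} [Group G]

/-- `H = ⁎ᵢ A i` as an internal free product of subgroups of `G`. -/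
def IsFreeFactorization {ι : Type*} (H : Subgroup G) (A : ι → Subgroup G) : Prop :=
  Function.Injective (Monoid.CoprodI.lift fun i => (A i).subtype) ∧
    (Monoid.CoprodI.lift fun i => (A i).subtype).range = H

/-- `A` is a free factor of `H`: `H = A * C` for some subgroup `C`. -/
def IsFreeFactor (A H : Subgroup G) : Prop :=
  ∃ C : Subgroup G, IsFreeFactorization H ![A, C]

/-- Conjugacy classes of subgroups of `G`. -/
def SubgroupClass (G : Type*) [Group G] : Type _ :=
  MulAction.orbitRel.Quotient (ConjAct G) (Subgroup G)

/-- The conjugacy class `[A]`. -/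
def conjClass (A : Subgroup G) : SubgroupClass G :=
  Quotient.mk (MulAction.orbitRel (ConjAct G) (Subgroup G)) A

/-- A subgroup system: a finite set of conjugacy classes of nontrivial subgroups of finite rank. -/
def IsSubgroupSystem (𝒜 : Set (SubgroupClass G)) : Prop :=
  𝒜.Finite ∧ ∀ A : Subgroup G, conjClass A ∈ 𝒜 → A ≠ ⊥ ∧ A.FG

/-- A free factor system: a subgroup system `{[A₁], …, [A_k]}` such that
`G = A₁ * ⋯ * A_k * B` for some (possibly trivial) subgroup `B`. -/
def IsFreeFactorSystem (𝒜 : Set (SubgroupClass G)) : Prop :=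
  IsSubgroupSystem 𝒜 ∧ ∃ (k : ℕ) (A : Fin k → Subgroup G) (B : Subgroup G),
    𝒜 = Set.range (fun i => conjClass (A i)) ∧
      IsFreeFactorization (⊤ : Subgroup G) (Fin.snoc (α := fun _ => Subgroup G) A B)

/-- The partial order `𝒜 ⊏ 𝒜'`. -/
def SystemLE (𝒜 𝒜' : Set (SubgroupClass G)) : Prop :=
  ∀ A : Subgroup G, conjClass A ∈ 𝒜 → ∃ A' : Subgroup G, conjClass A' ∈ 𝒜' ∧ IsFreeFactor A A'

/-- `𝒜` is the meet of the collection `𝒞` of free factor systems: the greatest free factor system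
that is `⊏` every member of `𝒞`. -/
def IsMeet (𝒞 : Set (Set (SubgroupClass G))) (𝒜 : Set (SubgroupClass G)) : Prop :=
  IsFreeFactorSystem 𝒜 ∧ (∀ 𝒜' ∈ 𝒞, SystemLE 𝒜 𝒜') ∧
    ∀ 𝒟 : Set (SubgroupClass G), IsFreeFactorSystem 𝒟 → (∀ 𝒜' ∈ 𝒞, SystemLE 𝒟 𝒜') → SystemLE 𝒟 𝒜

end Systems

/-! ### Carrying and filling -/

/-- `𝒜` carries `ℓ`: there are `[A] ∈ 𝒜` and a lift of `ℓ` with both endpoints in `∂A`. -/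
def Carries {n : ℕ} (𝒜 : Set (SubgroupClass (FreeGroup (Fin n)))) (ℓ : Line n) : Prop :=
  ∃ A : Subgroup (FreeGroup (Fin n)), conjClass A ∈ 𝒜 ∧
    ∃ p : EndpointPair n, Line.mk p = ℓ ∧ p.1.1 ∈ boundaryOf A ∧ p.1.2 ∈ boundaryOf A

/-- `𝒜` is the free factor support of the set `B` of lines: the meet of all free factor systems
that carry every line of `B`. -/
def IsFreeFactorSupport {n : ℕ} (B : Set (Line n))
    (𝒜 : Set (SubgroupClass (FreeGroup (Fin n)))) : Prop :=
  IsMeet {𝒜' | IsFreeFactorSystem 𝒜' ∧ ∀ ℓ ∈ B, Carries 𝒜' ℓ} 𝒜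

/-- `B` is filling: its free factor support is `{[F_n]}`. -/
def IsFilling {n : ℕ} (B : Set (Line n)) : Prop :=
  IsFreeFactorSupport B {conjClass ⊤}

end FreeLines

/-!
A finite graph over the rose whose pullback to the Cayley tree is again a tree presents a free
action of the free group on that tree. If the free splitting given by an edge of the tree is crossed
by no line of a filling set, then the vertex groups of the splitting carry the set; so the lines of
`B₁`, and those of `B₂`, cross every edge.

Start from the rose, and as long as at some vertex the turns taken by the lines of `B₁ ∪ B₂` fall
apart after removal of one direction, unfold the graph along that direction. Each step adds a vertex
and keeps the rank and the lifts of the lines. Were it to go on forever, the graphs, whose rank is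
at most `n`, would contain arbitrarily long segments of vertices of valence two; a line of `B₁` and
one of `B₂` which cross the middle of such a segment agree along it, and by compactness `cl(B₁)` and
`cl(B₂)` would meet.

The neighbourhood of `b` consists of the lines that take the turns which `b` takes in the final
graph. If `F * C` is the whole group, the elements whose normal form begins in `C` form an almost
invariant set, and no translate of it separates the endpoints of a line carried by `[F]`. If `[F]`
carried a line in every neighbourhood, then the turns that it takes in the tree would suffice to
propagate membership of ends in this set from one edge to the next, so the set would contain either
all ends or none; but it contains ends of `C` and no ends of `F`.
-/

namespace FreeLines

open Filter Topology
open scoped Pointwise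

section HalfSpace

variable {X : Type*} {Γ : SimpleGraph X} {x y v w v' w' : X} {H H' : Set X}

theorem forall_of_forall_adj (hΓ : Γ.Preconnected) {p : X → Prop} (hx : p x)
    (hadj : ∀ ⦃y z⦄, Γ.Adj y z → p y → p z) (y : X) : p y := by
  have hxy := (Γ.reachable_iff_reflTransGen x y).mp (hΓ x y)
  induction hxy with
  | refl => exact hx
  | tail _ hyz ih => exact hadj hyz ih

/-- The half space `H` beyond the oriented edge from `v` to `w`: among the edges of `Γ` it is the
only one that enters `H`. In a tree this determines `H`, see `IsHalfSpace.unique`. -/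
structure IsHalfSpace (Γ : SimpleGraph X) (v w : X) (H : Set X) : Prop where
  notMem : v ∉ H
  mem : w ∈ H
  eq_of_adj : ∀ ⦃y z⦄, Γ.Adj y z → y ∉ H → z ∈ H → y = v ∧ z = w

namespace IsHalfSpace

theorem compl (h : IsHalfSpace Γ v w H) : IsHalfSpace Γ w v Hᶜ where
  notMem := not_not_intro h.mem
  mem := h.notMem
  eq_of_adj _ _ hyz hy hz := (h.eq_of_adj hyz.symm hz (not_not.mp hy)).symm

theorem disjoint (hΓ : Γ.Preconnected) (hvw : Γ.Adj v w) (hvw' : Γ.Adj v' w')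
    (h : IsHalfSpace Γ v w H) (h' : IsHalfSpace Γ v' w' H') (hv : v ∉ H') (hv' : v' ∉ H)
    (hne : (v, w) ≠ (v', w')) : Disjoint H H' := by
  have hw : w ∉ H' := fun hw => hne (by
    obtain ⟨rfl, rfl⟩ := h'.eq_of_adj hvw hv hw
    rfl)
  have hw' : w' ∉ H := fun hw' => hne (by
    obtain ⟨rfl, rfl⟩ := h.eq_of_adj hvw' hv' hw'
    rfl)
  refine Set.disjoint_left.mpr fun z hz hz' => hv ?_
  refine (forall_of_forall_adj hΓ (p := fun z => z ∈ H ∩ H') ⟨hz, hz'⟩ (fun y z hyz hy => ?_) v).2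
  refine ⟨by_contra fun hz => hw ?_, by_contra fun hz => hw' ?_⟩
  · exact (h.eq_of_adj hyz.symm hz hy.1).2 ▸ hy.2
  · exact (h'.eq_of_adj hyz.symm hz hy.2).2 ▸ hy.1

theorem subset (hΓ : Γ.Preconnected) (h : IsHalfSpace Γ v w H) (h' : IsHalfSpace Γ v w H') :
    H ⊆ H' := by
  intro x hx
  by_contra hx'
  refine h.notMem (forall_of_forall_adj hΓ (p := fun z => z ∈ H ∧ z ∉ H') ⟨hx, hx'⟩
    (fun y z hyz hy => ?_) v).1
  have hz : z ∈ H := by_contra fun hz =>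
    hy.2 ((h.eq_of_adj hyz.symm hz hy.1).2 ▸ h'.mem)
  exact ⟨hz, fun hz' => h.notMem ((h'.eq_of_adj hyz hy.2 hz').1 ▸ hy.1)⟩

theorem unique (hΓ : Γ.Preconnected) (h : IsHalfSpace Γ v w H) (h' : IsHalfSpace Γ v w H') :
    H = H' :=
  (h.subset hΓ h').antisymm (h'.subset hΓ h)

end IsHalfSpace

/-- The vertices that remain connected to `w` when the edge from `v` to `w` is removed. -/
def halfSpace (Γ : SimpleGraph X) (v w : X) : Set X :=
  {x | (Γ.deleteEdges {s(v, w)}).Reachable w x}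

theorem isHalfSpace_halfSpace (hΓ : Γ.IsAcyclic) (hvw : Γ.Adj v w) :
    IsHalfSpace Γ v w (halfSpace Γ v w) where
  notMem h := SimpleGraph.isAcyclic_iff_forall_adj_isBridge.mp hΓ hvw h.symm
  mem := .rfl
  eq_of_adj y z hyz hy hz := by
    by_cases he : s(y, z) = s(v, w)
    · rcases Sym2.eq_iff.mp he with h | ⟨rfl, rfl⟩
      · exact h
      · exact (hy .rfl).elim
    · refine (hy (SimpleGraph.Reachable.trans hz (SimpleGraph.Adj.reachable ?_))).elim
      exact SimpleGraph.deleteEdges_adj.mpr ⟨hyz.symm, fun h => he (Sym2.eq_swap.trans h)⟩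

theorem isAcyclic_of_exists_isHalfSpace
    (h : ∀ v w, Γ.Adj v w → ∃ H, IsHalfSpace Γ v w H) : Γ.IsAcyclic := by
  refine SimpleGraph.isAcyclic_iff_forall_adj_isBridge.mpr fun v w hvw hreach => ?_
  obtain ⟨H, hH⟩ := h v w hvw
  have hxH : ∀ x, Relation.ReflTransGen (Γ.deleteEdges {s(v, w)}).Adj v x → x ∉ H := by
    intro x hvx
    induction hvx with
    | refl => exact hH.notMem
    | tail _ hyz ih =>
      intro hz
      obtain ⟨hyz, hne⟩ := SimpleGraph.deleteEdges_adj.mp hyz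
      obtain ⟨rfl, rfl⟩ := hH.eq_of_adj hyz ih hz
      exact hne rfl
  exact hxH w ((SimpleGraph.reachable_iff_reflTransGen _ _).mp hreach) hH.mem

theorem halfSpace_swap (hΓ : Γ.IsTree) (hvw : Γ.Adj v w) :
    halfSpace Γ w v = (halfSpace Γ v w)ᶜ :=
  (isHalfSpace_halfSpace hΓ.isAcyclic hvw.symm).unique hΓ.connected.preconnected
    (isHalfSpace_halfSpace hΓ.isAcyclic hvw).compl

end HalfSpace

section InvariantGraph

variable {G X : Type*} [Group G] [MulAction G X]

/-- The action of `G` preserves adjacency in `Γ`. -/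
def IsInvariant (G : Type*) [Group G] [MulAction G X] (Γ : SimpleGraph X) : Prop :=
  ∀ (g : G) ⦃x y : X⦄, Γ.Adj x y → Γ.Adj (g • x) (g • y)

variable {Γ : SimpleGraph X} {v w : X} {H : Set X}

theorem IsHalfSpace.smul (hG : IsInvariant G Γ) (h : IsHalfSpace Γ v w H) (g : G) :
    IsHalfSpace Γ (g • v) (g • w) (g • H) where
  notMem := by simpa using h.notMem
  mem := by simpa using h.mem
  eq_of_adj y z hyz hy hz := by
    rw [Set.mem_smul_set_iff_inv_smul_mem] at hy hz
    obtain ⟨rfl, rfl⟩ := h.eq_of_adj (hG g⁻¹ hyz) hy hz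
    simp

theorem halfSpace_smul (hΓ : Γ.IsTree) (hG : IsInvariant G Γ) (hvw : Γ.Adj v w) (g : G) :
    halfSpace Γ (g • v) (g • w) = g • halfSpace Γ v w :=
  (isHalfSpace_halfSpace hΓ.isAcyclic (hG g hvw)).unique hΓ.connected.preconnected
    ((isHalfSpace_halfSpace hΓ.isAcyclic hvw).smul hG g)

/-- A set that separates only finitely many translates of each pair of points. -/
def AlmostInvariant (G : Type*) [Group G] [MulAction G X] (H : Set X) : Prop :=
  ∀ x y : X, {g : G | ¬ (g • x ∈ H ↔ g • y ∈ H)}.Finite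

theorem AlmostInvariant.compl (h : AlmostInvariant G H) : AlmostInvariant G Hᶜ := fun x y => by
  simpa only [Set.mem_compl_iff, not_iff_not] using h x y

theorem AlmostInvariant.smul (h : AlmostInvariant G H) (a : G) : AlmostInvariant G (a • H) := by
  intro x y
  refine ((h x y).preimage (f := fun g => a⁻¹ * g) (mul_right_injective a⁻¹).injOn).subset ?_
  intro g hg
  simpa [Set.mem_smul_set_iff_inv_smul_mem, mul_smul] using hg

theorem IsHalfSpace.eq_smul_or_eq_smul_of_adj (hG : IsInvariant G Γ) (h : IsHalfSpace Γ v w H)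
    {x y : X} (hxy : Γ.Adj x y) {g : G} (hg : ¬ (g • x ∈ H ↔ g • y ∈ H)) :
    (g • x = v ∧ g • y = w) ∨ (g • x = w ∧ g • y = v) := by
  by_cases hx : g • x ∈ H
  · exact Or.inr (h.eq_of_adj (hG g hxy.symm) (fun hy => hg (iff_of_true hx hy)) hx).symm
  · exact Or.inl (h.eq_of_adj (hG g hxy) hx (by_contra fun hy => hg (iff_of_false hx hy)))

theorem IsHalfSpace.almostInvariant [IsCancelSMul G X] (hΓ : Γ.Preconnected)
    (hG : IsInvariant G Γ) (h : IsHalfSpace Γ v w H) : AlmostInvariant G H := by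
  intro x
  refine forall_of_forall_adj hΓ (x := x) (by simp) fun y z hyz hy => ?_
  have subsingleton (u : X) : {g : G | g • y = u}.Finite :=
    Set.Subsingleton.finite fun g hg k hk => IsCancelSMul.right_cancel g k y (hg.trans hk.symm)
  refine (hy.union ((subsingleton v).union (subsingleton w))).subset fun g hg => ?_
  by_cases hgy : g • x ∈ H ↔ g • y ∈ H
  · have hgyz : ¬ (g • y ∈ H ↔ g • z ∈ H) := fun h' => hg (hgy.trans h')
    exact Or.inr ((h.eq_smul_or_eq_smul_of_adj hG hyz hgyz).imp And.left And.left)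
  · exact Or.inl hgy

end InvariantGraph

section FreeFactor

variable {G : Type*} [Group G]

theorem conjClass_eq_iff {A A' : Subgroup G} :
    conjClass A' = conjClass A ↔ ∃ g : ConjAct G, g • A = A' :=
  (Quotient.eq (r := MulAction.orbitRel (ConjAct G) (Subgroup G))).trans
    MulAction.orbitRel_apply

theorem eq_top_of_conjClass_top_eq {A : Subgroup G} (h : conjClass ⊤ = conjClass A) : A = ⊤ := by
  obtain ⟨g, hg⟩ := conjClass_eq_iff.mp h
  exact eq_top_iff.mpr fun x _ => (Subgroup.smul_mem_pointwise_smul_iff (a := g)).mp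
    (hg ▸ Subgroup.mem_top _)

theorem ne_bot_and_fg_of_conjClass_eq {A A' : Subgroup G} (h : conjClass A' = conjClass A)
    (hbot : A ≠ ⊥) (hfg : A.FG) : A' ≠ ⊥ ∧ A'.FG := by
  obtain ⟨g, rfl⟩ := conjClass_eq_iff.mp h
  refine ⟨fun hg => hbot ?_, ?_⟩
  · rw [← inv_smul_smul g A, hg, Subgroup.smul_bot]
  · rw [Subgroup.fg_iff_submonoid_fg] at hfg ⊢
    exact hfg.map _

namespace IsFreeFactorization

variable {ι : Type*} {A : ι → Subgroup G}

/-- The isomorphism of a group with the free product of the factors of a free factorization. -/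
noncomputable def mulEquiv (h : IsFreeFactorization ⊤ A) : Monoid.CoprodI (fun i => A i) ≃* G :=
  MulEquiv.ofBijective _ ⟨h.1, MonoidHom.range_eq_top.mp h.2⟩

theorem mulEquiv_of (h : IsFreeFactorization ⊤ A) {i : ι} (a : A i) :
    h.mulEquiv (Monoid.CoprodI.of a) = a :=
  Monoid.CoprodI.lift_of _ _

theorem fg [Group.FG G] (h : IsFreeFactorization ⊤ A) (i : ι) : (A i).FG := by
  classical
  have hretract : Function.Surjective
      ((Monoid.CoprodI.lift (Pi.mulSingle i (MonoidHom.id (A i)))).comp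
        h.mulEquiv.symm.toMonoidHom) :=
    (Monoid.CoprodI.of_leftInverse (M := fun i => A i) i).surjective.comp h.mulEquiv.symm.surjective
  exact (Group.fg_iff_subgroup_fg _).mp (Group.fg_of_surjective hretract)

theorem induction (h : IsFreeFactorization ⊤ A) {p : G → Prop} (one : p 1)
    (mem : ∀ i, ∀ a ∈ A i, p a) (mul : ∀ a b, p a → p b → p (a * b)) (g : G) : p g := by
  obtain ⟨m, rfl⟩ := h.mulEquiv.surjective g
  induction m using Monoid.CoprodI.induction_on with
  | one => rwa [map_one]
  | of i a => rw [h.mulEquiv_of]; exact mem i a a.2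
  | mul a b ha hb => rw [map_mul]; exact mul _ _ ha hb

end IsFreeFactorization

theorem eq_top_of_isFreeFactor_top {A : Subgroup G} (h : IsFreeFactor ⊤ A) : A = ⊤ := by
  obtain ⟨C, -, hC⟩ := h
  rw [eq_top_iff, ← hC]
  exact fun x hx => ⟨Monoid.CoprodI.of (M := fun i => (![⊤, C] : Fin 2 → Subgroup G) i) (i := 0)
    ⟨x, hx⟩, Monoid.CoprodI.lift_of _ _⟩

section CoprodInclusion

variable {ι κ : Type*} {A : ι → Subgroup G} {A' : κ → Subgroup G} {f : ι → κ}

/-- The homomorphism of free products that sends each factor `A i`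
to the factor `A' (f i)`. -/
def coprodInclusion (hf : ∀ i, A i ≤ A' (f i)) :
    Monoid.CoprodI (fun i => A i) →* Monoid.CoprodI fun j => A' j :=
  Monoid.CoprodI.lift fun i =>
    (Monoid.CoprodI.of (M := fun j => A' j)).comp (Subgroup.inclusion (hf i))

theorem coprodInclusion_of (hf : ∀ i, A i ≤ A' (f i)) {i : ι} (x : A i) :
    coprodInclusion hf (Monoid.CoprodI.of x) =
      Monoid.CoprodI.of (M := fun j => A' j) (Subgroup.inclusion (hf i) x) :=
  Monoid.CoprodI.lift_of _ _

theorem lift_comp_coprodInclusion (hf : ∀ i, A i ≤ A' (f i)) :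
    (Monoid.CoprodI.lift fun j => (A' j).subtype).comp (coprodInclusion hf) =
      Monoid.CoprodI.lift fun i => (A i).subtype := by
  refine Monoid.CoprodI.ext_hom _ _ fun i => MonoidHom.ext fun x => ?_
  simp only [MonoidHom.comp_apply, coprodInclusion_of, Monoid.CoprodI.lift_of]
  rfl

theorem coprodInclusion_surjective (hf : ∀ i, A' (f i) = A i)
    (hbot : ∀ j ∉ Set.range f, A' j = ⊥) :
    Function.Surjective (coprodInclusion fun i => (hf i).ge) := by
  intro m
  induction m using Monoid.CoprodI.induction_on with
  | one => exact ⟨1, map_one _⟩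
  | of j x =>
    by_cases hj : j ∈ Set.range f
    · obtain ⟨i, rfl⟩ := hj
      exact ⟨Monoid.CoprodI.of (⟨x, (hf i).le x.2⟩ : A i), coprodInclusion_of _ _⟩
    · refine ⟨1, ?_⟩
      have hx : x = 1 := Subtype.ext (Subgroup.mem_bot.mp ((hbot j hj).le x.2))
      rw [hx, map_one, map_one]
  | mul a b ha hb =>
    obtain ⟨a', rfl⟩ := ha
    obtain ⟨b', rfl⟩ := hb
    exact ⟨a' * b', map_mul _ _ _⟩

theorem IsFreeFactorization.of_eq_bot {H : Subgroup G} (h : IsFreeFactorization H A)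
    (hf : ∀ i, A' (f i) = A i) (hbot : ∀ j ∉ Set.range f, A' j = ⊥) :
    IsFreeFactorization H A' := by
  have hsurj := coprodInclusion_surjective hf hbot
  have hcomp := lift_comp_coprodInclusion fun i => (hf i).ge
  constructor
  · refine fun a b hab => ?_
    obtain ⟨a', rfl⟩ := hsurj a
    obtain ⟨b', rfl⟩ := hsurj b
    rw [← MonoidHom.comp_apply, ← MonoidHom.comp_apply, hcomp] at hab
    rw [h.1 hab]
  · rw [← h.2, ← hcomp, MonoidHom.range_comp, MonoidHom.range_eq_top.mpr hsurj,
      MonoidHom.range_eq_map]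

theorem IsFreeFactorization.snoc_bot {k : ℕ} {H : Subgroup G} {A : Fin k → Subgroup G}
    (h : IsFreeFactorization H A) :
    IsFreeFactorization H (Fin.snoc (α := fun _ => Subgroup G) A ⊥) := by
  refine h.of_eq_bot (f := Fin.castSucc) (fun i => Fin.snoc_castSucc _ _ i) fun j hj => ?_
  induction j using Fin.lastCases with
  | last => exact Fin.snoc_last _ _
  | cast i => exact (hj ⟨i, rfl⟩).elim

end CoprodInclusion

theorem isFreeFactorSystem_singleton [Group.FG G] {A C : Subgroup G}
    (h : IsFreeFactorization ⊤ ![A, C]) (hA : A ≠ ⊥) : IsFreeFactorSystem {conjClass A} := by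
  refine ⟨⟨Set.finite_singleton _, fun A' hA' => ne_bot_and_fg_of_conjClass_eq hA' hA (h.fg 0)⟩,
    1, ![A], C, by simp, ?_⟩
  convert h using 1
  funext i
  fin_cases i <;> rfl

theorem isFreeFactorSystem_pair [Group.FG G] {A C : Subgroup G} (h : IsFreeFactorization ⊤ ![A, C])
    (hA : A ≠ ⊥) (hC : C ≠ ⊥) : IsFreeFactorSystem {conjClass A, conjClass C} := by
  refine ⟨⟨Set.toFinite _, fun A' hA' => ?_⟩, 2, ![A, C], ⊥, ?_, h.snoc_bot⟩
  · exact hA'.elim (fun hA' => ne_bot_and_fg_of_conjClass_eq hA' hA (h.fg 0))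
      fun hC' => ne_bot_and_fg_of_conjClass_eq hC' hC (h.fg 1)
  · ext c
    simp [Fin.exists_fin_two, eq_comm]

theorem IsFreeFactorization.ne_bot_of_not_isCyclic {A : Subgroup G} {t : G}
    (h : IsFreeFactorization ⊤ ![A, Subgroup.zpowers t]) (hG : ¬ IsCyclic G) : A ≠ ⊥ := by
  rintro rfl
  refine hG ⟨t, h.induction (p := (· ∈ Subgroup.zpowers t)) (one_mem _)
    (Fin.forall_fin_two.mpr ⟨fun a ha => ?_, fun _ => id⟩) fun _ _ => mul_mem⟩
  rw [Subgroup.mem_bot.mp ha]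
  exact one_mem _

theorem not_isCyclic_freeGroup {n : ℕ} (hn : 2 ≤ n) : ¬ IsCyclic (FreeGroup (Fin n)) := by
  intro h
  have hcomm : FreeGroup.of (⟨0, by omega⟩ : Fin n) * FreeGroup.of ⟨1, by omega⟩ =
      FreeGroup.of ⟨1, by omega⟩ * FreeGroup.of ⟨0, by omega⟩ :=
    IsCyclic.isMulCommutative.is_comm.comm _ _
  have hword := congrArg FreeGroup.toWord hcomm
  simp [FreeGroup.toWord_mul, FreeGroup.reduce.cons] at hword

theorem infinite_of_ne_bot [IsMulTorsionFree G] {A : Subgroup G} (h : A ≠ ⊥) : Infinite A := by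
  obtain ⟨a, ha, ha1⟩ := A.bot_or_exists_ne_one.resolve_left h
  exact Set.infinite_coe_iff.mpr <|
    (infinite_zpowers.mpr (not_isOfFinOrder_of_isMulTorsionFree ha1)).mono
      (Subgroup.zpowers_le.mpr ha)

open Cardinal in
theorem isFreeFactorization_of_ping_pong [IsMulTorsionFree G] {α : Type*} [MulAction G α]
    {A C : Subgroup G} {X : Set α} (hX : X.Nonempty) (hXc : Xᶜ.Nonempty)
    (hA : ∀ a ∈ A, a ≠ 1 → ∀ y ∉ X, a • y ∈ X) (hC : ∀ c ∈ C, c ≠ 1 → ∀ x ∈ X, c • x ∉ X)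
    (hbot : C ≠ ⊥) (htop : A ⊔ C = ⊤) : IsFreeFactorization ⊤ ![A, C] := by
  constructor
  · refine Monoid.CoprodI.lift_injective_of_ping_pong
      (H := fun i => (![A, C] : Fin 2 → Subgroup G) i) _ (Or.inr ⟨1, ?_⟩) ![X, Xᶜ] ?_ ?_ ?_
    · have : Infinite C := infinite_of_ne_bot hbot
      exact ofNat_le_aleph0.trans (aleph0_le_mk C)
    · exact Fin.forall_fin_two.mpr ⟨hX, hXc⟩
    · intro i j hij
      fin_cases i <;> fin_cases j
      exacts [(hij rfl).elim, disjoint_compl_right, disjoint_compl_left, (hij rfl).elim]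
    · intro i j hij g hg
      rintro _ ⟨y, hy, rfl⟩
      fin_cases i <;> fin_cases j
      exacts [(hij rfl).elim, hA _ g.2 (fun h => hg (Subtype.ext h)) y hy,
        hC _ g.2 (fun h => hg (Subtype.ext h)) y hy,
        (hij rfl).elim]
  · rw [Monoid.CoprodI.range_eq_iSup, eq_top_iff, ← htop]
    exact sup_le (A.range_subtype.ge.trans (le_iSup_of_le (0 : Fin 2) le_rfl))
      (C.range_subtype.ge.trans (le_iSup_of_le (1 : Fin 2) le_rfl))

end FreeFactor

section Splitting

variable {G X : Type*} [Group G] [MulAction G X]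

/-- No translate of `H` separates `x` from `y`. When `H` is a half space of a tree, the classes of
this relation are the components left after removing the whole orbit of the edge of `H`. -/
def Unseparated (G : Type*) [Group G] [MulAction G X] (H : Set X) (x y : X) : Prop :=
  ∀ g : G, g • x ∈ H ↔ g • y ∈ H

namespace Unseparated

variable {H : Set X} {x y z : X}

theorem refl (H : Set X) (x : X) : Unseparated G H x x := fun _ => Iff.rfl

theorem symm (h : Unseparated G H x y) : Unseparated G H y x := fun g => (h g).symm

theorem trans (h : Unseparated G H x y) (h' : Unseparated G H y z) : Unseparated G H x z :=
  fun g => (h g).trans (h' g)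

theorem mem_iff (h : Unseparated G H x y) : x ∈ H ↔ y ∈ H := by simpa using h 1

theorem smul (h : Unseparated G H x y) (a : G) : Unseparated G H (a • x) (a • y) := fun g => by
  simpa only [mul_smul] using h (g * a)

theorem smul_right {a : G} (h : Unseparated G H (a • x) y) : Unseparated G H x (a⁻¹ • y) := by
  simpa using h.smul a⁻¹

theorem compl_iff : Unseparated G Hᶜ x y ↔ Unseparated G H x y := by
  simp only [Unseparated, Set.mem_compl_iff, not_iff_not]

end Unseparated

/-- The elements that move `x` to a point not separated from it by any translate of `H`. -/
def classStabilizer (G : Type*) [Group G] [MulAction G X] (H : Set X) (x : X) : Subgroup G where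
  carrier := {g | Unseparated G H (g • x) x}
  one_mem' := by simpa using Unseparated.refl H x
  mul_mem' {a b} ha hb := by
    rw [Set.mem_ofPred_eq, mul_smul]
    exact (Unseparated.smul hb a).trans ha
  inv_mem' ha := ha.smul_right.symm

variable {H : Set X} {x y : X}

theorem mem_classStabilizer {g : G} :
    g ∈ classStabilizer G H x ↔ Unseparated G H (g • x) x := Iff.rfl

theorem inv_mul_mem_classStabilizer {g k : G} (h : Unseparated G H (g • x) (k • x)) :
    k⁻¹ * g ∈ classStabilizer G H x := by
  simpa [mem_classStabilizer, mul_smul] using h.smul k⁻¹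

theorem conj_mem_classStabilizer_iff {t : G} (ht : Unseparated G H (t • x) y) {g : G} :
    t * g * t⁻¹ ∈ classStabilizer G H y ↔ g ∈ classStabilizer G H x := by
  have hconj : Unseparated G H ((t * g * t⁻¹) • y) ((t * g) • x) := by
    simpa [mul_smul] using (ht.smul (t * g * t⁻¹)).symm
  refine ⟨fun h => ?_, fun h => ?_⟩
  · simpa using inv_mul_mem_classStabilizer ((hconj.symm.trans h).trans ht.symm)
  · rw [mul_smul t g] at hconj
    exact (hconj.trans (Unseparated.smul h t)).trans ht

theorem classStabilizer_compl (H : Set X) (x : X) :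
    classStabilizer G Hᶜ x = classStabilizer G H x :=
  Subgroup.ext fun _ => Unseparated.compl_iff

theorem classStabilizer_le_sup_zpowers {t : G} (ht : Unseparated G H (t • v) w) :
    classStabilizer G H w ≤ classStabilizer G H v ⊔ Subgroup.zpowers t := by
  intro g hg
  have ht_mem : t ∈ classStabilizer G H v ⊔ Subgroup.zpowers t :=
    Subgroup.mem_sup_right (Subgroup.mem_zpowers t)
  have hconj : t⁻¹ * g * t ∈ classStabilizer G H v :=
    (conj_mem_classStabilizer_iff ht).mp (by simpa [mul_assoc] using hg)
  simpa [mul_assoc] using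
    mul_mem (mul_mem ht_mem (Subgroup.mem_sup_left hconj)) (inv_mem ht_mem)

theorem mem_sup_zpowers_of_unseparated {t : G} (ht : Unseparated G H (t • v) w) {g : G}
    (hg : Unseparated G H (g • v) w) : g ∈ classStabilizer G H v ⊔ Subgroup.zpowers t := by
  have h := inv_mul_mem_classStabilizer (hg.trans ht.symm)
  simpa using mul_mem (Subgroup.mem_sup_right (Subgroup.mem_zpowers t)) (Subgroup.mem_sup_left h)

namespace IsHalfSpace

variable {Γ : SimpleGraph X} {v w : X}

theorem not_unseparated (h : IsHalfSpace Γ v w H) : ¬ Unseparated G H v w :=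
  fun hvw => h.notMem (hvw.mem_iff.mpr h.mem)

theorem unseparated_or_of_adj (hG : IsInvariant G Γ) (h : IsHalfSpace Γ v w H)
    (hxy : Γ.Adj x y) : Unseparated G H x y ∨
      ∃ g : G, (x = g • v ∧ y = g • w) ∨ (x = g • w ∧ y = g • v) := by
  refine or_iff_not_imp_left.mpr fun hsep => ?_
  obtain ⟨g, hg⟩ := not_forall.mp hsep
  refine ⟨g⁻¹, (h.eq_smul_or_eq_smul_of_adj hG hxy hg).imp ?_ ?_⟩ <;>
  · rintro ⟨rfl, rfl⟩
    simp

theorem exists_mem_unseparated (hΓ : Γ.Preconnected) (hG : IsInvariant G Γ)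
    (h : IsHalfSpace Γ v w H) {K : Subgroup G} (hv : classStabilizer G H v ≤ K)
    (hw : classStabilizer G H w ≤ K) (hvw : ∀ g : G, Unseparated G H (g • v) w → g ∈ K) (x : X) :
    ∃ g ∈ K, Unseparated G H x (g • v) ∨ Unseparated G H x (g • w) := by
  refine forall_of_forall_adj hΓ (x := v)
    (p := fun x => ∃ g ∈ K, Unseparated G H x (g • v) ∨ Unseparated G H x (g • w))
    ?_ (fun y z hyz => ?_) x
  · exact ⟨1, K.one_mem, Or.inl (by simpa using Unseparated.refl H v)⟩
  rintro ⟨k, hk, hu⟩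
  rcases h.unseparated_or_of_adj hG hyz with hyz | ⟨g, ⟨rfl, rfl⟩ | ⟨rfl, rfl⟩⟩
  · exact ⟨k, hk, hu.imp hyz.symm.trans hyz.symm.trans⟩
  · refine ⟨g, ?_, Or.inr (.refl _ _)⟩
    have hkg : k⁻¹ * g ∈ K := hu.elim (fun hu => hv (inv_mul_mem_classStabilizer hu))
      fun hu => hvw _ (by simpa [mul_smul] using hu.smul k⁻¹)
    simpa using K.mul_mem hk hkg
  · refine ⟨g, ?_, Or.inl (.refl _ _)⟩
    have hgk : g⁻¹ * k ∈ K := hu.elim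
      (fun hu => hvw _ (by simpa [mul_smul] using hu.symm.smul g⁻¹))
      fun hu => hw (inv_mul_mem_classStabilizer hu.symm)
    simpa using K.mul_mem hk (K.inv_mem hgk)

theorem eq_top_of_classStabilizer_le (hΓ : Γ.Preconnected) (hG : IsInvariant G Γ)
    (h : IsHalfSpace Γ v w H) {K : Subgroup G} (hv : classStabilizer G H v ≤ K)
    (hw : classStabilizer G H w ≤ K) (hvw : ∀ g : G, Unseparated G H (g • v) w → g ∈ K) :
    K = ⊤ := by
  refine eq_top_iff.mpr fun g _ => ?_
  obtain ⟨k, hk, hu⟩ := h.exists_mem_unseparated hΓ hG hv hw hvw (g • v)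
  have hkg : k⁻¹ * g ∈ K := hu.elim (fun hu => hv (inv_mul_mem_classStabilizer hu))
    fun hu => hvw _ (by simpa [mul_smul] using hu.smul k⁻¹)
  simpa using K.mul_mem hk hkg

theorem smul_notMem_of_mem_classStabilizer [IsCancelSMul G X] (hΓ : Γ.Preconnected)
    (hG : IsInvariant G Γ) (hvw : Γ.Adj v w) (h : IsHalfSpace Γ v w H) {g : G}
    (hg : g ∈ classStabilizer G H v) (hg1 : g ≠ 1) (hx : x ∈ H) : g • x ∉ H := by
  have hdisj : Disjoint H (g • H) := by
    refine h.disjoint hΓ hvw (hG g hvw) (h.smul hG g) ?_ ?_ ?_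
    · rw [Set.mem_smul_set_iff_inv_smul_mem]
      exact fun hv => h.notMem ((Unseparated.mem_iff (inv_mem hg)).mp hv)
    · exact fun hv => h.notMem ((Unseparated.mem_iff hg).mp hv)
    · exact fun he => hg1 (IsCancelSMul.eq_one_of_smul (congrArg Prod.fst he).symm)
  exact fun hgx => Set.disjoint_left.mp hdisj hgx (Set.smul_mem_smul_set hx)

theorem eq_one_of_mem_classStabilizer [IsCancelSMul G X] (hΓ : Γ.Preconnected)
    (hG : IsInvariant G Γ) (hvw : Γ.Adj v w) (h : IsHalfSpace Γ v w H) {g : G}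
    (hg : g ∈ classStabilizer G H v) (hg' : g ∈ classStabilizer G H w) : g = 1 :=
  not_not.mp fun hg1 => h.smul_notMem_of_mem_classStabilizer hΓ hG hvw hg hg1 h.mem
    ((Unseparated.mem_iff hg').mpr h.mem)

theorem classStabilizer_ne_bot [Finite (MulAction.orbitRel.Quotient G X)] (hG : IsInvariant G Γ)
    (h : IsHalfSpace Γ v w H) (hsep : ∀ g : G, ¬ Unseparated G H (g • v) w) {y : ℕ → X}
    (hy0 : y 0 = v) (hy1 : y 1 ≠ w) (hadj : ∀ i, Γ.Adj (y i) (y (i + 1)))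
    (hinj : Function.Injective y) : classStabilizer G H v ≠ ⊥ := by
  intro hbot
  have hstab {g : G} (hg : Unseparated G H (g • v) v) : g = 1 := by
    rw [← mem_classStabilizer, hbot] at hg
    exact Subgroup.mem_bot.mp hg
  -- leaving the class of `v` would mean crossing the edge from `v` to `w` itself
  have hy (i : ℕ) : Unseparated G H (y i) v := by
    induction i with
    | zero => exact hy0 ▸ .refl H _
    | succ i ih =>
      rcases h.unseparated_or_of_adj hG (hadj i) with hi | ⟨g, ⟨hi, hi'⟩ | ⟨hi, -⟩⟩
      · exact hi.symm.trans ih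
      · obtain rfl := hstab (hi ▸ ih)
        rw [one_smul] at hi hi'
        obtain rfl : i = 0 := hinj (hi.trans hy0.symm)
        exact (hy1 hi').elim
      · exact (hsep g⁻¹ (hi ▸ ih).smul_right.symm).elim
  obtain ⟨i, j, hij, hq⟩ := Finite.exists_ne_map_eq_of_infinite
    fun i => (Quotient.mk'' (y i) : MulAction.orbitRel.Quotient G X)
  obtain ⟨g, hg⟩ := Quotient.exact hq
  have hgi : Unseparated G H (g • y j) v := by
    rw [show g • y j = y i from hg]
    exact hy i
  obtain rfl := hstab ((Unseparated.smul (hy j) g).symm.trans hgi)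
  exact hij (hinj (hg.symm.trans (one_smul _ _)))

theorem isFreeFactorization_of_separating [IsMulTorsionFree G] [IsCancelSMul G X]
    (hΓ : Γ.Preconnected) (hG : IsInvariant G Γ) (hvw : Γ.Adj v w) (h : IsHalfSpace Γ v w H)
    (hsep : ∀ g : G, ¬ Unseparated G H (g • v) w) (hbot : classStabilizer G H w ≠ ⊥) :
    IsFreeFactorization ⊤ ![classStabilizer G H v, classStabilizer G H w] := by
  refine isFreeFactorization_of_ping_pong (X := Hᶜ) ⟨v, h.notMem⟩ ⟨w, not_not_intro h.mem⟩ ?_ ?_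
    hbot (h.eq_top_of_classStabilizer_le hΓ hG le_sup_left le_sup_right
      fun g hg => (hsep g hg).elim)
  · exact fun a ha ha1 y hy =>
      h.smul_notMem_of_mem_classStabilizer hΓ hG hvw ha ha1 (not_not.mp hy)
  · intro c hc hc1 y hy
    rw [← classStabilizer_compl] at hc
    exact h.compl.smul_notMem_of_mem_classStabilizer hΓ hG hvw.symm hc hc1 hy

section NonSeparating

variable {t : G}

theorem exists_unseparated_smul (hΓ : Γ.Preconnected) (hG : IsInvariant G Γ)
    (h : IsHalfSpace Γ v w H) (ht : Unseparated G H (t • v) w) (x : X) :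
    ∃ g : G, Unseparated G H x (g • v) := by
  obtain ⟨g, -, hg | hg⟩ := h.exists_mem_unseparated hΓ hG (K := ⊤) le_top le_top
    (fun g _ => Subgroup.mem_top g) x
  · exact ⟨g, hg⟩
  · exact ⟨g * t, hg.trans (by simpa [mul_smul] using (ht.smul g).symm)⟩

theorem smul_mem_of_unseparated [IsMulTorsionFree G] [IsCancelSMul G X] (hΓ : Γ.Preconnected)
    (hG : IsInvariant G Γ) (hvw : Γ.Adj v w) (h : IsHalfSpace Γ v w H)
    (ht : Unseparated G H (t • v) w) (hx : x ∈ H) : t • x ∈ H := by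
  have ht1 : t ≠ 1 := by
    rintro rfl
    exact h.not_unseparated (by simpa using ht)
  have hdisj : Disjoint Hᶜ (t • H) := by
    refine h.compl.disjoint hΓ hvw.symm (hG t hvw) (h.smul hG t) ?_ ?_ fun he => ?_
    · rw [Set.mem_smul_set_iff_inv_smul_mem]
      exact fun hw => h.notMem (ht.smul_right.mem_iff.mpr hw)
    · exact not_not_intro (ht.mem_iff.mpr h.mem)
    · have hw : w = t • v := congrArg Prod.fst he
      have hv : v = t • w := congrArg Prod.snd he
      -- otherwise `t` inverts the edge, so that `t ^ 2` fixes `v`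
      have ht2 : t ^ 2 = 1 := IsCancelSMul.eq_one_of_smul (x := v) (by
        rw [pow_two, mul_smul, ← hw, ← hv])
      exact ht1 ((pow_eq_one_iff_left two_ne_zero).mp ht2)
  by_contra htx
  exact Set.disjoint_left.mp hdisj htx (Set.smul_mem_smul_set hx)

theorem monotone_zpow_smul_mem [IsMulTorsionFree G] [IsCancelSMul G X] (hΓ : Γ.Preconnected)
    (hG : IsInvariant G Γ) (hvw : Γ.Adj v w) (h : IsHalfSpace Γ v w H)
    (ht : Unseparated G H (t • v) w) (x : X) : Monotone fun k : ℤ => t ^ k • x ∈ H :=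
  monotone_int_of_le_succ fun k hk => by
    rw [add_comm, zpow_one_add, mul_smul]
    exact h.smul_mem_of_unseparated hΓ hG hvw ht hk

/-- Collapsing all other edge orbits turns the tree into that of an HNN extension over the trivial
group, with stable letter `t`. -/
theorem isFreeFactorization_of_nonseparating [IsMulTorsionFree G] [IsCancelSMul G X]
    (hΓ : Γ.Preconnected) (hG : IsInvariant G Γ) (hvw : Γ.Adj v w) (h : IsHalfSpace Γ v w H)
    (ht : Unseparated G H (t • v) w) :
    IsFreeFactorization ⊤ ![classStabilizer G H v, Subgroup.zpowers t] := by
  have ht_stab {a : G} (ha : a ∈ classStabilizer G H v) {y : X} (hy : y ∈ H) : t • a • y ∈ H := by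
    have hta : Unseparated G H ((t * a) • v) w := by
      rw [mul_smul]
      exact (Unseparated.smul ha t).trans ht
    simpa [mul_smul] using h.smul_mem_of_unseparated hΓ hG hvw hta hy
  have ht1 : t ≠ 1 := by
    rintro rfl
    exact h.not_unseparated (by simpa using ht)
  refine isFreeFactorization_of_ping_pong (X := {y | y ∉ H ∧ t • y ∈ H})
    ⟨v, h.notMem, ht.mem_iff.mpr h.mem⟩ ⟨w, fun hwX => hwX.1 h.mem⟩ (fun a ha ha1 y hy => ?_)
    ?_ (fun hbot => ht1 (Subgroup.zpowers_eq_bot.mp hbot))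
    (h.eq_top_of_classStabilizer_le hΓ hG le_sup_left (classStabilizer_le_sup_zpowers ht)
      fun g => mem_sup_zpowers_of_unseparated ht)
  · by_cases hyH : y ∈ H
    · exact ⟨h.smul_notMem_of_mem_classStabilizer hΓ hG hvw ha ha1 hyH, ht_stab ha hyH⟩
    have hty : t • y ∉ H := fun hty => hy ⟨hyH, hty⟩
    refine ⟨fun hay => hty (by simpa using ht_stab (inv_mem ha) hay), ?_⟩
    have hconj := (conj_mem_classStabilizer_iff ht).mpr ha
    rw [← classStabilizer_compl] at hconj
    simpa [mul_smul] using h.compl.smul_notMem_of_mem_classStabilizer hΓ hG hvw.symm hconj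
      (by simpa using ha1) hty
  · rintro _ ⟨k, rfl⟩ hk x ⟨hx, htx⟩ ⟨hkx, htkx⟩
    have hmono := h.monotone_zpow_smul_mem hΓ hG hvw ht x
    rcases lt_or_gt_of_ne (show k ≠ 0 by rintro rfl; simp at hk) with hk | hk
    · refine hx ?_
      simpa using hmono (show 1 + k ≤ 0 by omega)
        (show t ^ (1 + k) • x ∈ H by rw [zpow_one_add, mul_smul]; exact htkx)
    · exact hkx (hmono (show 1 ≤ k by omega) (show t ^ (1 : ℤ) • x ∈ H by rwa [zpow_one]))

end NonSeparating

end IsHalfSpace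

end Splitting

section Rays

variable {n : ℕ}

theorem Letter.inv_ne (s : Letter n) : s.inv ≠ s := by
  simp [Letter.inv, Prod.ext_iff]

theorem Letter.isReduced_pair_iff {s t : Letter n} :
    FreeGroup.IsReduced [t, s] ↔ t ≠ s.inv := by
  obtain ⟨i, a⟩ := s
  obtain ⟨j, b⟩ := t
  cases a <;> cases b <;> simp [Letter.inv]

/-- The element of the free group represented by the one-letter word `s`. -/
def ofLetter (s : Letter n) : FreeGroup (Fin n) := FreeGroup.mk [s]

theorem ofLetter_inv (s : Letter n) : ofLetter s.inv = (ofLetter s)⁻¹ := by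
  simp [ofLetter, Letter.inv, FreeGroup.inv_mk, FreeGroup.invRev]

theorem toWord_ofLetter (s : Letter n) : (ofLetter s).toWord = [s] := by
  simp [ofLetter]

theorem ofLetter_injective : Function.Injective (ofLetter : Letter n → FreeGroup (Fin n)) :=
  fun s t h => by simpa [toWord_ofLetter] using congrArg FreeGroup.toWord h

theorem ofLetter_ne_one (s : Letter n) : ofLetter s ≠ 1 :=
  fun h => by simpa [toWord_ofLetter] using congrArg FreeGroup.toWord h

theorem ofLetter_smul (s : Letter n) (ξ : Boundary n) : ofLetter s • ξ = letterMul s ξ := by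
  have hsmul (g : FreeGroup (Fin n)) : g • ξ = FreeGroup.lift (generatorPerm (n := n)) g ξ := rfl
  obtain ⟨x, _ | _⟩ := s
  · have hinv : ofLetter (x, false) = (FreeGroup.of x)⁻¹ := ofLetter_inv (x, true)
    rw [hsmul, hinv, map_inv, FreeGroup.lift_apply_of]
    rfl
  · rw [hsmul, ofLetter, ← FreeGroup.of, FreeGroup.lift_apply_of]
    rfl

theorem mul_ofLetter_induction {p : FreeGroup (Fin n) → Prop} (one : p 1)
    (mul_ofLetter : ∀ g s, p g → p (g * ofLetter s)) (g : FreeGroup (Fin n)) : p g := by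
  suffices h : ∀ L : List (Letter n), p (FreeGroup.mk L) by
    simpa only [FreeGroup.mk_toWord] using h g.toWord
  intro L
  induction L using List.reverseRecOn with
  | nil => exact one
  | append_singleton L s ih =>
    rw [← FreeGroup.mul_mk]
    exact mul_ofLetter _ _ ih

/-- The vertex of the Cayley tree reached after `m` letters of the ray `ξ`. -/
def rayVertex (ξ : Boundary n) (m : ℕ) : FreeGroup (Fin n) :=
  FreeGroup.mk (List.ofFn fun i : Fin m => ξ.1 i)

@[simp] theorem rayVertex_zero (ξ : Boundary n) : rayVertex ξ 0 = 1 := rfl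

theorem rayVertex_succ (ξ : Boundary n) (m : ℕ) :
    rayVertex ξ (m + 1) = rayVertex ξ m * ofLetter (ξ.1 m) := by
  rw [rayVertex, List.ofFn_succ', List.concat_eq_append, ← FreeGroup.mul_mk]
  rfl

theorem rayVertex_one (ξ : Boundary n) : rayVertex ξ 1 = ofLetter (ξ.1 0) := by
  simp [rayVertex_succ]

theorem isReduced_ofFn (ξ : Boundary n) (m : ℕ) :
    FreeGroup.IsReduced (List.ofFn fun i : Fin m => ξ.1 i) := by
  rw [FreeGroup.IsReduced, List.isChain_iff_getElem]
  intro i hi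
  simp only [List.getElem_ofFn]
  have hpair : ξ.1 i ≠ (ξ.1 (i + 1)).inv := fun h => ξ.2 i (by rw [h, Letter.inv_inv])
  exact (FreeGroup.isReduced_cons_cons.mp (Letter.isReduced_pair_iff.mpr hpair)).1

theorem toWord_rayVertex (ξ : Boundary n) (m : ℕ) :
    (rayVertex ξ m).toWord = List.ofFn fun i : Fin m => ξ.1 i := by
  rw [rayVertex, FreeGroup.toWord_mk, (isReduced_ofFn ξ m).reduce_eq]

theorem norm_rayVertex (ξ : Boundary n) (m : ℕ) : (rayVertex ξ m).norm = m := by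
  rw [FreeGroup.norm, toWord_rayVertex, List.length_ofFn]

theorem rayVertex_injective (ξ : Boundary n) : Function.Injective (rayVertex ξ) := fun i j h => by
  rw [← norm_rayVertex ξ i, h, norm_rayVertex]

theorem rayVertex_congr {ξ η : Boundary n} {m : ℕ} (h : ∀ i < m, ξ.1 i = η.1 i) :
    rayVertex ξ m = rayVertex η m :=
  congrArg FreeGroup.mk (congrArg List.ofFn (funext fun i => h i i.2))

theorem toWord_rayVertex_isPrefix (ξ : Boundary n) {m k : ℕ} (hmk : m ≤ k) :
    (rayVertex ξ m).toWord <+: (rayVertex ξ k).toWord := by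
  induction hmk with
  | refl => exact List.prefix_rfl
  | step _ ih =>
    refine ih.trans ?_
    simp only [toWord_rayVertex]
    rw [List.ofFn_succ', List.concat_eq_append]
    exact List.prefix_append _ _

theorem ofLetter_smul_apply {s : Letter n} {ξ : Boundary n} (h : ξ.1 0 = s.inv) (i : ℕ) :
    (ofLetter s • ξ).1 i = ξ.1 (i + 1) := by
  rw [ofLetter_smul, letterMul, dif_pos h]

theorem ofLetter_smul_apply_zero {s : Letter n} {ξ : Boundary n} (h : ξ.1 0 ≠ s.inv) :
    (ofLetter s • ξ).1 0 = s := by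
  rw [ofLetter_smul, letterMul, dif_neg h]
  rfl

theorem ofLetter_smul_apply_succ {s : Letter n} {ξ : Boundary n} (h : ξ.1 0 ≠ s.inv) (i : ℕ) :
    (ofLetter s • ξ).1 (i + 1) = ξ.1 i := by
  rw [ofLetter_smul, letterMul, dif_neg h]

theorem ofLetter_inv_smul_apply (ξ : Boundary n) (i : ℕ) :
    ((ofLetter (ξ.1 0))⁻¹ • ξ).1 i = ξ.1 (i + 1) := by
  rw [← ofLetter_inv, ofLetter_smul_apply (Letter.inv_inv _).symm]

theorem rayVertex_inv_smul_apply (ξ : Boundary n) (m i : ℕ) :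
    ((rayVertex ξ m)⁻¹ • ξ).1 i = ξ.1 (m + i) := by
  induction m generalizing i with
  | zero => simp
  | succ m ih =>
    have h0 : ξ.1 m = ((rayVertex ξ m)⁻¹ • ξ).1 0 := (ih 0).symm
    rw [rayVertex_succ, mul_inv_rev, mul_smul, h0, ofLetter_inv_smul_apply, ih]
    exact congrArg ξ.1 (by omega)

theorem rayVertex_ofLetter_smul (s : Letter n) (ξ : Boundary n) :
    (∀ i, rayVertex (ofLetter s • ξ) i = ofLetter s * rayVertex ξ (i + 1)) ∨
      ∀ i, rayVertex (ofLetter s • ξ) (i + 1) = ofLetter s * rayVertex ξ i := by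
  by_cases h : ξ.1 0 = s.inv
  · refine Or.inl fun i => ?_
    induction i with
    | zero => rw [rayVertex_zero, zero_add, rayVertex_one, h, ofLetter_inv, mul_inv_cancel]
    | succ i ih =>
      rw [rayVertex_succ, ih, rayVertex_succ ξ (i + 1), ofLetter_smul_apply h, mul_assoc]
  · refine Or.inr fun i => ?_
    induction i with
    | zero => rw [zero_add, rayVertex_one, ofLetter_smul_apply_zero h, rayVertex_zero, mul_one]
    | succ i ih =>
      rw [rayVertex_succ, ih, rayVertex_succ ξ i, ofLetter_smul_apply_succ h, mul_assoc]

theorem finite_norm_le (N : ℕ) : {g : FreeGroup (Fin n) | g.norm ≤ N}.Finite := by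
  refine Set.Finite.of_finite_image (f := FreeGroup.toWord) ?_ FreeGroup.toWord_injective.injOn
  refine (List.finite_length_le (Letter n) N).subset ?_
  rintro _ ⟨g, hg, rfl⟩
  exact hg

theorem exists_rayVertex_smul (g : FreeGroup (Fin n)) (ξ : Boundary n) :
    ∃ j k, ∀ i, rayVertex (g • ξ) (j + i) = g * rayVertex ξ (k + i) := by
  induction g using mul_ofLetter_induction generalizing ξ with
  | one => exact ⟨0, 0, fun i => by simp⟩
  | mul_ofLetter g s ih =>
    obtain ⟨j, k, h⟩ := ih (ofLetter s • ξ)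
    rcases rayVertex_ofLetter_smul s ξ with hs | hs
    · refine ⟨j, k + 1, fun i => ?_⟩
      rw [mul_smul, h, hs, mul_assoc, add_right_comm]
    · refine ⟨j + 1, k, fun i => ?_⟩
      rw [mul_smul, add_right_comm, add_assoc, h, ← add_assoc, hs, mul_assoc]

theorem continuous_boundary_apply (i : ℕ) : Continuous fun ξ : Boundary n => ξ.1 i :=
  (continuous_apply i).comp continuous_subtype_val

theorem continuous_letterMul (s : Letter n) : Continuous (letterMul s) := by
  refine Continuous.subtype_mk (f := fun ξ => (letterMul s ξ).1) (continuous_pi fun i => ?_) _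
  have hcoord : (fun ξ : Boundary n => (letterMul s ξ).1 i) =
      (fun q : Letter n × Letter n × Letter n =>
        if q.1 = s.inv then q.2.1 else if i = 0 then s else q.2.2) ∘
      fun ξ => (ξ.1 0, ξ.1 (i + 1), ξ.1 (i - 1)) := by
    funext ξ
    by_cases h : ξ.1 0 = s.inv
    · simp [letterMul, h]
    · cases i <;> simp [letterMul, h]
  rw [hcoord]
  exact continuous_of_discreteTopology.comp ((continuous_boundary_apply _).prodMk
    ((continuous_boundary_apply _).prodMk (continuous_boundary_apply _)))

instance : ContinuousConstSMul (FreeGroup (Fin n)) (Boundary n) where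
  continuous_const_smul g := by
    induction g using mul_ofLetter_induction with
    | one => exact continuous_id.congr fun ξ => (one_smul _ ξ).symm
    | mul_ofLetter g s ih =>
      have hs : Continuous fun ξ : Boundary n => ofLetter s • ξ := by
        simpa only [ofLetter_smul] using continuous_letterMul s
      exact (ih.comp hs).congr fun ξ => (mul_smul g (ofLetter s) ξ).symm

instance : CompactSpace (Boundary n) := by
  have hclosed : IsClosed {w : ℕ → Letter n | ∀ i, w (i + 1) ≠ (w i).inv} := by
    rw [Set.ofPred_forall]
    refine isClosed_iInter fun i => ?_
    have hc : Continuous fun w : ℕ → Letter n => (w (i + 1), w i) :=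
      (continuous_apply _).prodMk (continuous_apply _)
    exact (isClosed_discrete {q : Letter n × Letter n | q.1 ≠ q.2.inv}).preimage hc
  exact isCompact_iff_compactSpace.mp hclosed.isCompact

theorem isOpen_cylinder (ξ : Boundary n) (N : ℕ) :
    IsOpen {ξ' : Boundary n | ∀ i < N, ξ'.1 i = ξ.1 i} := by
  have hinter : {ξ' : Boundary n | ∀ i < N, ξ'.1 i = ξ.1 i} =
      ⋂ i ∈ Set.Iio N, {ξ' | ξ'.1 i = ξ.1 i} := by
    ext
    simp
  rw [hinter]
  exact (Set.finite_Iio N).isOpen_biInter fun i _ =>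
    (isOpen_discrete {ξ.1 i}).preimage (continuous_boundary_apply i)

theorem toWord_mul_ofLetter (w : FreeGroup (Fin n)) (s : Letter n) :
    (w * ofLetter s).toWord = w.toWord ++ [s] ∨ w.toWord = (w * ofLetter s).toWord ++ [s.inv] := by
  have hw : FreeGroup.IsReduced w.toWord := FreeGroup.isReduced_toWord
  have hmul : w * ofLetter s = FreeGroup.mk (w.toWord ++ [s]) := by
    rw [← FreeGroup.mul_mk, FreeGroup.mk_toWord, ofLetter]
  rcases List.eq_nil_or_concat w.toWord with h | ⟨L, t, h⟩
  · left
    simp [hmul, h]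
  rw [List.concat_eq_append] at h
  rw [h] at hw
  by_cases hts : t = s.inv
  · right
    have hL : w * ofLetter s = FreeGroup.mk L := by
      rw [← FreeGroup.mk_toWord (x := w), h, ← FreeGroup.mul_mk, hts, ← ofLetter, ofLetter_inv,
        inv_mul_cancel_right]
    rw [hL, FreeGroup.toWord_mk, FreeGroup.IsReduced.reduce_eq
        (List.IsChain.left_of_append hw), h, hts]
  · left
    rw [hmul, FreeGroup.toWord_mk, h]
    exact (FreeGroup.IsReduced.append_overlap hw (Letter.isReduced_pair_iff.mpr hts)
      (by simp)).reduce_eq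

theorem isPrefix_toWord_mul {w r : FreeGroup (Fin n)} {l : List (Letter n)}
    (hl : l <+: w.toWord) (h : l.length + r.norm ≤ w.norm) : l <+: (w * r).toWord := by
  suffices key : ∀ (R : List (Letter n)) (w : FreeGroup (Fin n)), l <+: w.toWord →
      l.length + R.length ≤ w.toWord.length → l <+: (w * FreeGroup.mk R).toWord by
    simpa only [FreeGroup.mk_toWord] using key r.toWord w hl h
  intro R
  induction R with
  | nil => intro w hl _; simpa [← FreeGroup.one_eq_mk] using hl
  | cons s R ih =>
    intro w hl hlen
    have hmul : w * FreeGroup.mk (s :: R) = w * ofLetter s * FreeGroup.mk R := by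
      rw [mul_assoc, ofLetter, FreeGroup.mul_mk, List.singleton_append]
    rw [hmul]
    simp only [List.length_cons] at hlen
    rcases toWord_mul_ofLetter w s with hs | hs
    · refine ih _ ?_ ?_
      · exact hs ▸ hl.trans (List.prefix_append _ _)
      · simp only [hs, List.length_append, List.length_singleton]
        omega
    · have hlen' := congrArg List.length hs
      simp only [List.length_append, List.length_singleton] at hlen'
      refine ih _ ?_ (by omega)
      rw [hs] at hl
      exact List.prefix_of_prefix_length_le hl (List.prefix_append _ _) (by omega)

end Rays

section Covers

variable {n : ℕ} {V : Type*}

/-- The vertices of a graph over the Cayley tree of the free group: the fibre over each vertex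
`base` of the Cayley tree is a copy of `V`. -/
@[ext] structure Vert (n : ℕ) (V : Type*) where
  base : FreeGroup (Fin n)
  label : V

namespace Vert

instance : MulAction (FreeGroup (Fin n)) (Vert n V) where
  smul g z := ⟨g * z.base, z.label⟩
  one_smul z := Vert.ext (one_mul z.base) rfl
  mul_smul g h z := Vert.ext (mul_assoc g h z.base) rfl

@[simp] theorem base_smul (g : FreeGroup (Fin n)) (z : Vert n V) : (g • z).base = g * z.base := rfl

@[simp] theorem smul_mk (g h : FreeGroup (Fin n)) (u : V) : g • (⟨h, u⟩ : Vert n V) = ⟨g * h, u⟩ :=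
  rfl

instance : IsCancelSMul (FreeGroup (Fin n)) (Vert n V) where
  left_cancel' g _ _ h := smul_left_cancel g h
  right_cancel' _ _ _ h := mul_right_cancel (congrArg Vert.base h)

end Vert

/-- A graph with vertex set `V` whose oriented edges are labelled by letters, reversing an edge
inverting its label: a graph with a map to the rose. -/
structure LabelledGraph (n : ℕ) (V : Type*) where
  Edge : Letter n → V → V → Prop
  symm : ∀ ⦃s u v⦄, Edge s u v → Edge s.inv v u

namespace LabelledGraph

/-- The cover of a labelled graph that is pulled back from the Cayley tree covering the rose. -/
def cover (Δ : LabelledGraph n V) : SimpleGraph (Vert n V) where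
  Adj y z := ∃ s, z.base = y.base * ofLetter s ∧ Δ.Edge s y.label z.label
  symm := ⟨by
    rintro y z ⟨s, hs, h⟩
    exact ⟨s.inv, by rw [hs, ofLetter_inv, mul_inv_cancel_right], Δ.symm h⟩⟩
  loopless := ⟨by
    rintro y ⟨s, hs, -⟩
    exact ofLetter_ne_one s (mul_eq_left.mp hs.symm)⟩

variable (Δ : LabelledGraph n V)

theorem isInvariant_cover : IsInvariant (FreeGroup (Fin n)) Δ.cover := by
  rintro g y z ⟨s, hs, h⟩
  exact ⟨s, by rw [Vert.base_smul, Vert.base_smul, hs, mul_assoc], h⟩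

theorem cover_adj_mk {g : FreeGroup (Fin n)} {s : Letter n} {u v : V} :
    Δ.cover.Adj ⟨g, u⟩ ⟨g * ofLetter s, v⟩ ↔ Δ.Edge s u v := by
  refine ⟨?_, fun h => ⟨s, rfl, h⟩⟩
  rintro ⟨t, ht, h⟩
  rwa [ofLetter_injective (mul_left_cancel ht)]

end LabelledGraph

/-- A labelled graph whose cover is a tree, on which the free group then acts freely. -/
structure LabelledTree (n : ℕ) (V : Type*) extends LabelledGraph n V where
  isTree : toLabelledGraph.cover.IsTree

theorem LabelledTree.nonempty (T : LabelledTree n V) : Nonempty V :=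
  T.isTree.connected.nonempty.map Vert.label

end Covers

section Ends

variable {n : ℕ} {V : Type*} {H : Set (Vert n V)} {N : ℕ} {ξ : Boundary n}

/-- `H` is locally constant outside the ball of radius `N`. -/
def StableFrom (H : Set (Vert n V)) (N : ℕ) : Prop :=
  ∀ ⦃g a : FreeGroup (Fin n)⦄, N ≤ g.norm → a.norm ≤ 1 → ∀ u v : V,
    (⟨g, u⟩ : Vert n V) ∈ H ↔ ⟨g * a, v⟩ ∈ H

theorem AlmostInvariant.exists_stableFrom [Finite V]
    (h : AlmostInvariant (FreeGroup (Fin n)) H) : ∃ N, StableFrom H N := by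
  have hfin : (⋃ a ∈ {a : FreeGroup (Fin n) | a.norm ≤ 1}, ⋃ u : V, ⋃ v : V,
      {g : FreeGroup (Fin n) |
        ¬ (g • (⟨1, u⟩ : Vert n V) ∈ H ↔ g • (⟨a, v⟩ : Vert n V) ∈ H)}).Finite :=
    (finite_norm_le 1).biUnion fun _ _ =>
      Set.finite_iUnion fun _ => Set.finite_iUnion fun _ => h _ _
  obtain ⟨N, hN⟩ := (hfin.image FreeGroup.norm).bddAbove
  refine ⟨N + 1, fun g a hg ha u v => by_contra fun hne => ?_⟩
  have hgN : g.norm ≤ N := hN ⟨g, Set.mem_biUnion ha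
    (Set.mem_iUnion₂.mpr ⟨u, v, by simpa using hne⟩), rfl⟩
  omega

/-- The ray `ξ` eventually stays in `H`, whatever vertices it meets in the fibres. -/
def EndsIn (H : Set (Vert n V)) (ξ : Boundary n) : Prop :=
  ∀ᶠ i in atTop, ∀ u, (⟨rayVertex ξ i, u⟩ : Vert n V) ∈ H

theorem norm_ofLetter (s : Letter n) : (ofLetter s).norm = 1 := by
  rw [FreeGroup.norm, toWord_ofLetter, List.length_singleton]

theorem StableFrom.mem_rayVertex_iff (h : StableFrom H N) {i : ℕ} (hi : N ≤ i) (u v : V) :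
    (⟨rayVertex ξ i, u⟩ : Vert n V) ∈ H ↔ ⟨rayVertex ξ N, v⟩ ∈ H := by
  induction i, hi using Nat.le_induction generalizing u with
  | base => simpa using h (norm_rayVertex ξ N).ge (FreeGroup.norm_one.trans_le zero_le_one) u v
  | succ i hi ih =>
    rw [← ih u, rayVertex_succ]
    exact (h (by rwa [norm_rayVertex]) (norm_ofLetter _).le u u).symm

theorem StableFrom.endsIn_iff (h : StableFrom H N) {i : ℕ} (hi : N ≤ i) (u : V) :
    EndsIn H ξ ↔ (⟨rayVertex ξ i, u⟩ : Vert n V) ∈ H := by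
  refine ⟨fun hξ => ?_, fun hu => eventually_atTop.mpr ⟨N, fun j hj v => ?_⟩⟩
  · obtain ⟨j, hj, hNj⟩ := (hξ.and (eventually_ge_atTop N)).exists
    exact (h.mem_rayVertex_iff hi u u).mpr ((h.mem_rayVertex_iff hNj u u).mp (hj u))
  · exact (h.mem_rayVertex_iff hj v u).mpr ((h.mem_rayVertex_iff hi u u).mp hu)

namespace AlmostInvariant

variable [Finite V] (h : AlmostInvariant (FreeGroup (Fin n)) H)

include h

theorem endsIn_compl_iff [Nonempty V] : EndsIn Hᶜ ξ ↔ ¬ EndsIn H ξ := by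
  obtain ⟨N, hN⟩ := h.exists_stableFrom
  obtain ⟨N', hN'⟩ := h.compl.exists_stableFrom
  let u := Classical.arbitrary V
  rw [hN.endsIn_iff (le_max_left N N') u, hN'.endsIn_iff (le_max_right N N') u, Set.mem_compl_iff]

theorem endsIn_of_forall {u : ℕ → V} {k : ℕ}
    (hu : ∀ i, k ≤ i → (⟨rayVertex ξ i, u i⟩ : Vert n V) ∈ H) : EndsIn H ξ := by
  obtain ⟨N, hN⟩ := h.exists_stableFrom
  exact (hN.endsIn_iff (le_max_left N k) _).mpr (hu _ (le_max_right N k))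

theorem exists_endsIn_congr [Nonempty V] : ∃ N, ∀ ξ ξ' : Boundary n,
    (∀ i < N, ξ'.1 i = ξ.1 i) → (EndsIn H ξ' ↔ EndsIn H ξ) := by
  obtain ⟨N, hN⟩ := h.exists_stableFrom
  let u := Classical.arbitrary V
  refine ⟨N, fun ξ ξ' hξ => ?_⟩
  rw [hN.endsIn_iff le_rfl u, hN.endsIn_iff le_rfl u, rayVertex_congr hξ]

end AlmostInvariant

theorem EndsIn.mono {H' : Set (Vert n V)} (hH : H ⊆ H') (h : EndsIn H ξ) : EndsIn H' ξ :=
  Eventually.mono h fun _ hi u => hH (hi u)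

theorem EndsIn.smul (h : EndsIn H ξ) (g : FreeGroup (Fin n)) : EndsIn (g • H) (g • ξ) := by
  obtain ⟨j, k, hjk⟩ := exists_rayVertex_smul g ξ
  obtain ⟨m, hm⟩ := eventually_atTop.mp h
  refine eventually_atTop.mpr ⟨j + m, fun i hi u => ?_⟩
  obtain ⟨l, rfl⟩ := Nat.exists_eq_add_of_le hi
  rw [Set.mem_smul_set_iff_inv_smul_mem, add_assoc, hjk, Vert.smul_mk, inv_mul_cancel_left]
  exact hm (k + (m + l)) (by omega) u

end Ends

section Lines

variable {n : ℕ}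

/-- The lifts of the lines in `B`, as pairs of endpoints. -/
def lifts (B : Set (Line n)) : Set (Boundary n × Boundary n) :=
  {p | ∃ h : p.1 ≠ p.2, Line.mk ⟨p, h⟩ ∈ B}

variable {B B' : Set (Line n)} {p : Boundary n × Boundary n}

theorem line_mk_smul (g : FreeGroup (Fin n)) (h : p.1 ≠ p.2) (h' : (g • p).1 ≠ (g • p).2) :
    Line.mk ⟨g • p, h'⟩ = Line.mk ⟨p, h⟩ :=
  Quotient.sound (s := lineSetoid n) ⟨g⁻¹, Or.inl (inv_smul_smul g p)⟩

theorem line_mk_swap (h : p.1 ≠ p.2) (h' : p.swap.1 ≠ p.swap.2) :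
    Line.mk ⟨p.swap, h'⟩ = Line.mk ⟨p, h⟩ :=
  Quotient.sound (s := lineSetoid n) ⟨1, Or.inr (one_smul _ _)⟩

theorem smul_mem_lifts (hp : p ∈ lifts B) (g : FreeGroup (Fin n)) : g • p ∈ lifts B := by
  obtain ⟨h, hB⟩ := hp
  exact ⟨fun he => h (smul_left_cancel g he), by rwa [line_mk_smul g h]⟩

theorem swap_mem_lifts (hp : p ∈ lifts B) : p.swap ∈ lifts B := by
  obtain ⟨h, hB⟩ := hp
  exact ⟨h.symm, by rwa [line_mk_swap h]⟩

theorem lifts_mono (h : B ⊆ B') : lifts B ⊆ lifts B' :=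
  fun _ ⟨hne, hp⟩ => ⟨hne, h hp⟩

/-- The geodesic of the Cayley tree with endpoints `p` passes through the base vertex `1`. -/
def Pointed (p : Boundary n × Boundary n) : Prop := p.1.1 0 ≠ p.2.1 0

theorem Pointed.swap (h : Pointed p) : Pointed p.swap := Ne.symm h

theorem exists_pointed_smul (h : p.1 ≠ p.2) : ∃ g : FreeGroup (Fin n), Pointed (g • p) := by
  classical
  have hne : ∃ i, p.1.1 i ≠ p.2.1 i := by
    by_contra! he
    exact h (Subtype.ext (funext he))
  -- the translate that moves the branching point of the two rays to the base vertex
  let m := Nat.find hne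
  have hm : rayVertex p.1 m = rayVertex p.2 m :=
    rayVertex_congr fun i hi => not_not.mp (Nat.find_min hne hi)
  refine ⟨(rayVertex p.1 m)⁻¹, ?_⟩
  have h₂ : ((rayVertex p.1 m)⁻¹ • p.2).1 0 = p.2.1 m := by rw [hm, rayVertex_inv_smul_apply]; rfl
  have h₁ : ((rayVertex p.1 m)⁻¹ • p.1).1 0 = p.1.1 m := rayVertex_inv_smul_apply _ _ _
  simpa only [Pointed, Prod.smul_fst, Prod.smul_snd, h₁, h₂] using Nat.find_spec hne

theorem exists_pointed_mem_lifts {ℓ : Line n} (hℓ : ℓ ∈ B) :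
    ∃ p ∈ lifts B, Pointed p ∧ ∃ h : p.1 ≠ p.2, Line.mk ⟨p, h⟩ = ℓ := by
  obtain ⟨⟨p, hp⟩, rfl⟩ := Quotient.exists_rep ℓ
  obtain ⟨g, hg⟩ := exists_pointed_smul hp
  obtain ⟨hgp, hB⟩ := smul_mem_lifts (B := B) ⟨hp, hℓ⟩ g
  exact ⟨g • p, ⟨hgp, hB⟩, hg, hgp, line_mk_smul g hp hgp⟩

/-- The translate of `p` for which the vertex after the base vertex becomes the base vertex. -/
def step (p : Boundary n × Boundary n) : Boundary n × Boundary n := (ofLetter (p.1.1 0))⁻¹ • p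

theorem step_fst_apply (p : Boundary n × Boundary n) (i : ℕ) : (step p).1.1 i = p.1.1 (i + 1) :=
  ofLetter_inv_smul_apply p.1 i

theorem Pointed.step_snd_apply_zero (h : Pointed p) : (step p).2.1 0 = (p.1.1 0).inv := by
  change ((ofLetter (p.1.1 0))⁻¹ • p.2).1 0 = _
  rw [← ofLetter_inv, ofLetter_smul_apply_zero (by rw [Letter.inv_inv]; exact h.symm)]

theorem Pointed.step (h : Pointed p) : Pointed (step p) := by
  rw [Pointed, h.step_snd_apply_zero, step_fst_apply]
  exact p.1.2 0

theorem Pointed.step_swap_step (h : Pointed p) :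
    FreeLines.step (FreeLines.step p).swap = p.swap := by
  have hinv : (FreeLines.step p).swap.1.1 0 = (p.1.1 0).inv := h.step_snd_apply_zero
  rw [FreeLines.step, hinv, ofLetter_inv, inv_inv]
  exact congrArg Prod.swap (smul_inv_smul (ofLetter (p.1.1 0)) p)

theorem Pointed.iterate_step (h : Pointed p) (i : ℕ) : Pointed (FreeLines.step^[i] p) := by
  induction i with
  | zero => exact h
  | succ i ih => exact Function.iterate_succ_apply' FreeLines.step i p ▸ ih.step

theorem step_mem_lifts (hp : p ∈ lifts B) : step p ∈ lifts B := smul_mem_lifts hp _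

theorem iterate_step_mem_lifts (hp : p ∈ lifts B) (i : ℕ) : step^[i] p ∈ lifts B := by
  induction i with
  | zero => exact hp
  | succ i ih => exact Function.iterate_succ_apply' step i p ▸ step_mem_lifts ih

theorem iterate_step_fst_apply (p : Boundary n × Boundary n) (i j : ℕ) :
    (step^[i] p).1.1 j = p.1.1 (i + j) := by
  induction i generalizing p with
  | zero => rw [Function.iterate_zero_apply, zero_add]
  | succ i ih => rw [Function.iterate_succ_apply, ih, step_fst_apply, add_right_comm]

end Lines

section LineMap

variable {n : ℕ} {V : Type*}

/-- The other end of the edge from `z` to a vertex with label `d.2` whose letter is `d.1`. Such a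
pair `d` is called a direction. -/
def Vert.next (z : Vert n V) (d : Letter n × V) : Vert n V := ⟨z.base * ofLetter d.1, d.2⟩

theorem Vert.smul_next (g : FreeGroup (Fin n)) (z : Vert n V) (d : Letter n × V) :
    g • z.next d = (g • z).next d :=
  Vert.ext (mul_assoc _ _ _).symm rfl

theorem Vert.next_injective (z : Vert n V) : Function.Injective z.next := fun _ _ h =>
  Prod.ext (ofLetter_injective (mul_left_cancel (congrArg Vert.base h))) (congrArg Vert.label h)

theorem Vert.next_next_inv (z : Vert n V) (d : Letter n × V) :
    (z.next d).next (d.1.inv, z.label) = z :=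
  Vert.ext (by rw [Vert.next, Vert.next, ofLetter_inv, mul_inv_cancel_right]) rfl

theorem Vert.smul_one_label (z : Vert n V) : z.base • (⟨1, z.label⟩ : Vert n V) = z :=
  Vert.ext (mul_one _) rfl

/-- The directions of the edges at `u`. -/
def LabelledGraph.directions (Δ : LabelledGraph n V) (u : V) : Set (Letter n × V) :=
  {d | Δ.Edge d.1 u d.2}

theorem LabelledGraph.cover_adj_next {Δ : LabelledGraph n V} {z : Vert n V} {d : Letter n × V} :
    Δ.cover.Adj z (z.next d) ↔ d ∈ Δ.directions z.label :=
  Δ.cover_adj_mk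

theorem LabelledGraph.exists_eq_next {Δ : LabelledGraph n V} {y z : Vert n V}
    (h : Δ.cover.Adj y z) : ∃ d ∈ Δ.directions y.label, z = y.next d := by
  obtain ⟨s, hs, hE⟩ := h
  exact ⟨(s, z.label), hE, Vert.ext hs rfl⟩

namespace LabelledTree

/-- The half space beyond the edge at `z` in direction `d`. -/
def halfSpaceAt (T : LabelledTree n V) (z : Vert n V) (d : Letter n × V) : Set (Vert n V) :=
  halfSpace T.cover z (z.next d)

variable {T : LabelledTree n V} {z : Vert n V} {d : Letter n × V}

theorem isHalfSpace_halfSpaceAt (hd : d ∈ T.directions z.label) :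
    IsHalfSpace T.cover z (z.next d) (T.halfSpaceAt z d) :=
  isHalfSpace_halfSpace T.isTree.isAcyclic (LabelledGraph.cover_adj_next.mpr hd)

theorem almostInvariant_halfSpaceAt (hd : d ∈ T.directions z.label) :
    AlmostInvariant (FreeGroup (Fin n)) (T.halfSpaceAt z d) :=
  (isHalfSpace_halfSpaceAt hd).almostInvariant T.isTree.connected.preconnected T.isInvariant_cover

theorem halfSpaceAt_next (hd : d ∈ T.directions z.label) :
    T.halfSpaceAt (z.next d) (d.1.inv, z.label) = (T.halfSpaceAt z d)ᶜ := by
  rw [halfSpaceAt, z.next_next_inv]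
  exact halfSpace_swap T.isTree (LabelledGraph.cover_adj_next.mpr hd)

theorem halfSpaceAt_smul (hd : d ∈ T.directions z.label) (g : FreeGroup (Fin n)) :
    T.halfSpaceAt (g • z) d = g • T.halfSpaceAt z d := by
  rw [halfSpaceAt, ← z.smul_next]
  exact halfSpace_smul T.isTree T.isInvariant_cover (LabelledGraph.cover_adj_next.mpr hd) g

end LabelledTree

/-- An equivariant lift to the tree `T` of the lines of `B`, encoded by its value on pointed lines:
`lam p` labels the vertex of the lift of `p` in the fibre over the base vertex. -/
structure LineMap (T : LabelledTree n V) (B : Set (Line n)) where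
  lam : Boundary n × Boundary n → V
  lam_swap : ∀ p ∈ lifts B, Pointed p → lam p.swap = lam p
  edge : ∀ p ∈ lifts B, Pointed p → T.Edge (p.1.1 0) (lam p) (lam (step p))

namespace LineMap

variable {T : LabelledTree n V} {B B' : Set (Line n)} (φ : LineMap T B)
  {p : Boundary n × Boundary n} {u : V} {d : Letter n × V}

/-- The direction in which the lift of `p` leaves the base fibre. -/
def dir (p : Boundary n × Boundary n) : Letter n × V := (p.1.1 0, φ.lam (step p))

theorem dir_mem (hp : p ∈ lifts B) (h : Pointed p) : φ.dir p ∈ T.directions (φ.lam p) :=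
  φ.edge p hp h

theorem dir_swap_mem (hp : p ∈ lifts B) (h : Pointed p) :
    φ.dir p.swap ∈ T.directions (φ.lam p) := by
  rw [← φ.lam_swap p hp h]
  exact φ.dir_mem (swap_mem_lifts hp) h.swap

theorem dir_ne_dir_swap (h : Pointed p) : φ.dir p ≠ φ.dir p.swap :=
  fun he => h (congrArg Prod.fst he)

theorem dir_swap_step (hp : p ∈ lifts B) (h : Pointed p) :
    φ.dir (step p).swap = ((p.1.1 0).inv, φ.lam p) := by
  refine Prod.ext h.step_snd_apply_zero ?_
  change φ.lam (step (step p).swap) = _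
  rw [h.step_swap_step, φ.lam_swap p hp h]

/-- The lift of some line of `B'` crosses the edge at `u` in direction `d`. -/
def Crosses (B' : Set (Line n)) (u : V) (d : Letter n × V) : Prop :=
  ∃ p ∈ lifts B', Pointed p ∧ φ.lam p = u ∧ φ.dir p = d

theorem Crosses.reverse {φ : LineMap T B} (hB : B' ⊆ B) (h : φ.Crosses B' u d) :
    φ.Crosses B' d.2 (d.1.inv, u) := by
  obtain ⟨p, hp, hpp, rfl, rfl⟩ := h
  have hstep := step_mem_lifts hp
  exact ⟨(step p).swap, swap_mem_lifts hstep, hpp.step.swap,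
    φ.lam_swap _ (lifts_mono hB hstep) hpp.step, φ.dir_swap_step (lifts_mono hB hp) hpp⟩

/-- The vertices of the lift of `p`, starting in the base fibre. -/
def vert (p : Boundary n × Boundary n) (i : ℕ) : Vert n V :=
  ⟨rayVertex p.1 i, φ.lam (step^[i] p)⟩

theorem vert_succ (p : Boundary n × Boundary n) (i : ℕ) :
    φ.vert p (i + 1) = (φ.vert p i).next (φ.dir (step^[i] p)) := by
  refine Vert.ext ?_ (congrArg φ.lam (Function.iterate_succ_apply' step i p))
  change rayVertex p.1 (i + 1) = rayVertex p.1 i * ofLetter ((step^[i] p).1.1 0)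
  rw [rayVertex_succ, iterate_step_fst_apply, add_zero]

theorem vert_adj (hp : p ∈ lifts B) (h : Pointed p) (i : ℕ) :
    T.cover.Adj (φ.vert p i) (φ.vert p (i + 1)) := by
  rw [vert_succ]
  exact LabelledGraph.cover_adj_next.mpr
    (φ.dir_mem (iterate_step_mem_lifts hp i) (h.iterate_step i))

theorem vert_injective (p : Boundary n × Boundary n) : Function.Injective (φ.vert p) :=
  fun _ _ h => rayVertex_injective p.1 (congrArg Vert.base h)

theorem endsIn_halfSpaceAt [Finite V] (hp : p ∈ lifts B) (h : Pointed p) :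
    EndsIn (T.halfSpaceAt ⟨1, φ.lam p⟩ (φ.dir p)) p.1 := by
  have hd := φ.dir_mem hp h
  have hH := LabelledTree.isHalfSpace_halfSpaceAt (z := ⟨1, φ.lam p⟩) hd
  refine (LabelledTree.almostInvariant_halfSpaceAt hd).endsIn_of_forall
    (u := fun i => φ.lam (step^[i] p)) (k := 1) fun i hi => ?_
  change φ.vert p i ∈ _
  induction i, hi using Nat.le_induction with
  | base => exact φ.vert_succ p 0 ▸ hH.mem
  | succ i _ ih =>
    -- an injective path cannot come back to the vertex it started from
    by_contra hout
    have hback : φ.vert p (i + 1) = φ.vert p 0 := (hH.eq_of_adj (φ.vert_adj hp h i).symm hout ih).1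
    exact absurd (φ.vert_injective p hback) i.succ_ne_zero

theorem endsIn_halfSpaceAt_swap [Finite V] (hp : p ∈ lifts B) (h : Pointed p) :
    EndsIn (T.halfSpaceAt ⟨1, φ.lam p⟩ (φ.dir p.swap)) p.2 := by
  have hswap := φ.endsIn_halfSpaceAt (swap_mem_lifts hp) h.swap
  rwa [φ.lam_swap p hp h] at hswap

end LineMap

end LineMap

section Crossing

variable {n : ℕ} {V : Type*}

instance [Finite V] : Finite (MulAction.orbitRel.Quotient (FreeGroup (Fin n)) (Vert n V)) :=
  Finite.of_surjective (fun u => Quotient.mk'' ⟨1, u⟩) fun q => by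
    obtain ⟨z, rfl⟩ := Quotient.mk''_surjective q
    exact ⟨z.label, Quotient.sound ⟨z.base⁻¹, Vert.ext (inv_mul_cancel _) rfl⟩⟩

/-- The elements of the stabilizer that follow the ray are `rayVertex ξ i * (r w)⁻¹`, where
`⟨r w, w⟩` is a fixed vertex with label `w` in the class of `y`. -/
theorem mem_boundaryOf_classStabilizer [Finite V] {H : Set (Vert n V)} {ξ : Boundary n}
    {y : Vert n V} {u : ℕ → V} {k : ℕ}
    (h : ∀ i, k ≤ i → Unseparated (FreeGroup (Fin n)) H ⟨rayVertex ξ i, u i⟩ y) :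
    ξ ∈ boundaryOf (classStabilizer (FreeGroup (Fin n)) H y) := by
  have hr : ∀ w : V, ∃ r : FreeGroup (Fin n), ∀ g : FreeGroup (Fin n),
      Unseparated (FreeGroup (Fin n)) H ⟨g, w⟩ y → Unseparated (FreeGroup (Fin n)) H ⟨r, w⟩ y := by
    intro w
    by_cases hw : ∃ g : FreeGroup (Fin n), Unseparated (FreeGroup (Fin n)) H ⟨g, w⟩ y
    · exact ⟨hw.choose, fun _ _ => hw.choose_spec⟩
    · exact ⟨1, fun g hg => (hw ⟨g, hg⟩).elim⟩
  choose r hr using hr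
  obtain ⟨M, hM⟩ := (Set.finite_range fun w => (r w)⁻¹.norm).bddAbove
  intro m
  let i := m + M + k
  have hi := h i (Nat.le_add_left _ _)
  refine ⟨rayVertex ξ i * (r (u i))⁻¹, ?_, isPrefix_toWord_mul ?_ ?_⟩
  · have hsmul := (hr (u i) _ hi).smul (rayVertex ξ i * (r (u i))⁻¹)
    rw [Vert.smul_mk, inv_mul_cancel_right] at hsmul
    exact hsmul.symm.trans hi
  · rw [← toWord_rayVertex]
    exact toWord_rayVertex_isPrefix ξ (by omega)
  · have hnorm : (r (u i))⁻¹.norm ≤ M := hM ⟨u i, rfl⟩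
    rw [norm_rayVertex, List.length_ofFn]
    omega

namespace LineMap

variable {T : LabelledTree n V} {B B' : Set (Line n)} (φ : LineMap T B)
  {p : Boundary n × Boundary n} {y z : Vert n V} {d : Letter n × V}

theorem crosses_of_vert_eq (hp : p ∈ lifts B') (h : Pointed p) {i : ℕ} (hy : φ.vert p i = y)
    (hy' : φ.vert p (i + 1) = y.next d) : φ.Crosses B' y.label d := by
  subst hy
  refine ⟨step^[i] p, iterate_step_mem_lifts hp i, h.iterate_step i, rfl, ?_⟩
  rw [vert_succ] at hy'
  exact Vert.next_injective _ hy'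

theorem unseparated_vert (hB : B' ⊆ B) (hd : d ∈ T.directions z.label)
    (hc : ¬ φ.Crosses B' z.label d) (hp : p ∈ lifts B') (h : Pointed p) (i : ℕ) :
    Unseparated (FreeGroup (Fin n)) (T.halfSpaceAt z d) (φ.vert p i) ⟨1, φ.lam p⟩ := by
  induction i with
  | zero => exact .refl _ _
  | succ i ih =>
    rcases (LabelledTree.isHalfSpace_halfSpaceAt hd).unseparated_or_of_adj T.isInvariant_cover
      (φ.vert_adj (lifts_mono hB hp) h i) with hi | ⟨g, ⟨hi, hi'⟩ | ⟨hi, hi'⟩⟩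
    · exact hi.symm.trans ih
    · exact (hc (φ.crosses_of_vert_eq (y := g • z) hp h hi (hi'.trans (z.smul_next g d)))).elim
    · rw [← z.next_next_inv d, Vert.smul_next] at hi'
      have hback := (φ.crosses_of_vert_eq (y := g • z.next d) hp h hi hi').reverse hB
      rw [Letter.inv_inv] at hback
      exact (hc hback).elim

theorem inv_smul_fst_mem_boundaryOf [Finite V] (hB : B' ⊆ B) (hd : d ∈ T.directions z.label)
    (hc : ¬ φ.Crosses B' z.label d) (hp : p ∈ lifts B') (h : Pointed p) {g : FreeGroup (Fin n)}
    (hy : Unseparated (FreeGroup (Fin n)) (T.halfSpaceAt z d) ⟨1, φ.lam p⟩ (g • y)) :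
    g⁻¹ • p.1 ∈ boundaryOf (classStabilizer (FreeGroup (Fin n)) (T.halfSpaceAt z d) y) := by
  obtain ⟨j, k, hjk⟩ := exists_rayVertex_smul g⁻¹ p.1
  refine mem_boundaryOf_classStabilizer (k := j)
    (u := fun i => φ.lam (step^[k + (i - j)] p)) fun i hi => ?_
  obtain ⟨l, rfl⟩ := Nat.exists_eq_add_of_le hi
  have hsmul := ((φ.unseparated_vert hB hd hc hp h (k + l)).trans hy).smul g⁻¹
  simpa [vert, hjk] using hsmul

theorem carries_of_not_crosses [Finite V] (hB : B' ⊆ B) (hd : d ∈ T.directions z.label)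
    (hc : ¬ φ.Crosses B' z.label d) {𝒜 : Set (SubgroupClass (FreeGroup (Fin n)))}
    (h𝒜 : ∀ x, ∃ y, conjClass (classStabilizer (FreeGroup (Fin n)) (T.halfSpaceAt z d) y) ∈ 𝒜 ∧
      ∃ g : FreeGroup (Fin n), Unseparated (FreeGroup (Fin n)) (T.halfSpaceAt z d) x (g • y))
    {ℓ : Line n} (hℓ : ℓ ∈ B') : Carries 𝒜 ℓ := by
  obtain ⟨p, hp, hpp, hne, rfl⟩ := exists_pointed_mem_lifts hℓ
  obtain ⟨y, hy, g, hg⟩ := h𝒜 ⟨1, φ.lam p⟩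
  have hgp : (g⁻¹ • p).1 ≠ (g⁻¹ • p).2 := (smul_mem_lifts hp g⁻¹).1
  refine ⟨_, hy, ⟨g⁻¹ • p, hgp⟩, line_mk_smul _ hne hgp,
    φ.inv_smul_fst_mem_boundaryOf hB hd hc hp hpp hg,
    φ.inv_smul_fst_mem_boundaryOf hB hd hc (swap_mem_lifts hp) hpp.swap ?_⟩
  rwa [φ.lam_swap p (lifts_mono hB hp) hpp]

theorem exists_dir_ne (hvis : ∀ v, ∃ p ∈ lifts B, Pointed p ∧ φ.lam p = v) (u : V)
    (d : Letter n × V) : ∃ p ∈ lifts B, Pointed p ∧ φ.lam p = u ∧ φ.dir p ≠ d := by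
  obtain ⟨p, hp, hpp, rfl⟩ := hvis u
  by_cases hd : φ.dir p = d
  · exact ⟨p.swap, swap_mem_lifts hp, hpp.swap, φ.lam_swap p hp hpp,
      hd ▸ (φ.dir_ne_dir_swap hpp).symm⟩
  · exact ⟨p, hp, hpp, rfl, hd⟩

theorem classStabilizer_ne_bot [Finite V]
    (hvis : ∀ v, ∃ p ∈ lifts B, Pointed p ∧ φ.lam p = v) (hd : d ∈ T.directions z.label)
    (hsep : ∀ g : FreeGroup (Fin n),
      ¬ Unseparated (FreeGroup (Fin n)) (T.halfSpaceAt z d) (g • z) (z.next d)) :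
    classStabilizer (FreeGroup (Fin n)) (T.halfSpaceAt z d) z ≠ ⊥ := by
  obtain ⟨p, hp, hpp, hpz, hpd⟩ := φ.exists_dir_ne hvis z.label d
  have hz : z.base • φ.vert p 0 = z := Vert.ext (mul_one _) hpz
  refine (LabelledTree.isHalfSpace_halfSpaceAt hd).classStabilizer_ne_bot T.isInvariant_cover hsep
    (y := fun i => z.base • φ.vert p i) hz ?_
    (fun i => T.isInvariant_cover z.base (φ.vert_adj hp hpp i))
    fun i j hij => φ.vert_injective p (smul_left_cancel _ hij)
  rw [φ.vert_succ p 0, Vert.smul_next, hz]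
  exact fun he => hpd (z.next_injective he)

end LineMap

theorem conjClass_top_mem_of_isFilling {B : Set (Line n)} (h : IsFilling B)
    {𝒜 : Set (SubgroupClass (FreeGroup (Fin n)))} (h𝒜 : IsFreeFactorSystem 𝒜)
    (hc : ∀ ℓ ∈ B, Carries 𝒜 ℓ) : conjClass ⊤ ∈ 𝒜 := by
  obtain ⟨A, hA, htop⟩ := h.2.1 𝒜 ⟨h𝒜, hc⟩ ⊤ rfl
  rwa [eq_top_of_isFreeFactor_top htop] at hA

namespace LineMap

variable [Finite V] {T : LabelledTree n V} {B B' : Set (Line n)} (φ : LineMap T B) (hB : B' ⊆ B)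
  (hfill : IsFilling B') {z : Vert n V} {d : Letter n × V} (hd : d ∈ T.directions z.label)

include hB hfill hd

theorem crosses_of_nonseparating (hn : 2 ≤ n) {t : FreeGroup (Fin n)}
    (ht : Unseparated (FreeGroup (Fin n)) (T.halfSpaceAt z d) (t • z) (z.next d)) :
    φ.Crosses B' z.label d := by
  by_contra hc
  have hH := LabelledTree.isHalfSpace_halfSpaceAt hd
  have hT := T.isTree.connected.preconnected
  have hF := hH.isFreeFactorization_of_nonseparating hT T.isInvariant_cover
    (LabelledGraph.cover_adj_next.mpr hd) ht
  have htop := conjClass_top_mem_of_isFilling hfill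
    (isFreeFactorSystem_singleton hF (hF.ne_bot_of_not_isCyclic (not_isCyclic_freeGroup hn)))
    fun _ => φ.carries_of_not_crosses hB hd hc fun x =>
      ⟨z, Set.mem_singleton _, hH.exists_unseparated_smul hT T.isInvariant_cover ht x⟩
  have ht_mem : t ∈ classStabilizer (FreeGroup (Fin n)) (T.halfSpaceAt z d) z := by
    rw [eq_top_of_conjClass_top_eq htop]
    exact Subgroup.mem_top t
  exact hH.not_unseparated (ht_mem.symm.trans ht)

theorem crosses_of_separating (hvis : ∀ v, ∃ p ∈ lifts B, Pointed p ∧ φ.lam p = v)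
    (hsep : ∀ g : FreeGroup (Fin n),
      ¬ Unseparated (FreeGroup (Fin n)) (T.halfSpaceAt z d) (g • z) (z.next d)) :
    φ.Crosses B' z.label d := by
  by_contra hc
  have hH := LabelledTree.isHalfSpace_halfSpaceAt hd
  have hT := T.isTree.connected.preconnected
  have hadj := LabelledGraph.cover_adj_next.mpr hd
  have hz := φ.classStabilizer_ne_bot hvis hd hsep
  have hz' : classStabilizer (FreeGroup (Fin n)) (T.halfSpaceAt z d) (z.next d) ≠ ⊥ := by
    have hne := φ.classStabilizer_ne_bot (z := z.next d) (d := (d.1.inv, z.label)) hvis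
      (T.symm hd) fun g hg => ?_
    · rwa [LabelledTree.halfSpaceAt_next hd, classStabilizer_compl] at hne
    · rw [LabelledTree.halfSpaceAt_next hd, z.next_next_inv, Unseparated.compl_iff] at hg
      exact hsep g⁻¹ hg.smul_right.symm
  have htop := conjClass_top_mem_of_isFilling hfill
    (isFreeFactorSystem_pair
      (hH.isFreeFactorization_of_separating hT T.isInvariant_cover hadj hsep hz') hz hz')
    fun _ => φ.carries_of_not_crosses hB hd hc fun x => by
      obtain ⟨g, -, hg | hg⟩ := hH.exists_mem_unseparated hT T.isInvariant_cover (K := ⊤) le_top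
        le_top (fun g _ => Subgroup.mem_top g) x
      exacts [⟨z, Or.inl rfl, g, hg⟩, ⟨z.next d, Or.inr rfl, g, hg⟩]
  rcases htop with htop | htop <;> have htop := eq_top_of_conjClass_top_eq htop
  · refine hz' ((Subgroup.eq_bot_iff_forall _).mpr fun g hg => ?_)
    exact hH.eq_one_of_mem_classStabilizer hT T.isInvariant_cover hadj
      (htop ▸ Subgroup.mem_top g) hg
  · refine hz ((Subgroup.eq_bot_iff_forall _).mpr fun g hg => ?_)
    exact hH.eq_one_of_mem_classStabilizer hT T.isInvariant_cover hadj hg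
      (htop ▸ Subgroup.mem_top g)

theorem crosses_of_isFilling (hn : 2 ≤ n)
    (hvis : ∀ v, ∃ p ∈ lifts B, Pointed p ∧ φ.lam p = v) : φ.Crosses B' z.label d := by
  by_cases h : ∃ t : FreeGroup (Fin n),
      Unseparated (FreeGroup (Fin n)) (T.halfSpaceAt z d) (t • z) (z.next d)
  · obtain ⟨t, ht⟩ := h
    exact φ.crosses_of_nonseparating hB hfill hd hn ht
  · exact φ.crosses_of_separating hB hfill hd hvis (not_exists.mp h)

end LineMap

end Crossing

section Unfold

variable {n : ℕ} {V : Type*}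

/-- The projection `Option V → V` that identifies the new vertex `none` with `v`. -/
def proj (v : V) (a : Option V) : V := a.getD v

/-- The directions at `v` that stay attached to each vertex of the unfolded graph: those of `X`
and `x` at the new vertex `none`, those outside `X` at `some v`. -/
def Attached (v : V) (x : Letter n × V) (X : Set (Letter n × V)) : Option V → Letter n × V → Prop
  | none, d => d ∈ X ∨ d = x
  | some u, d => u = v → d ∉ X

variable {v : V} {x d : Letter n × V} {X : Set (Letter n × V)}

theorem Attached.unique {a a' : Option V} (h : Attached v x X a d) (h' : Attached v x X a' d)
    (hp : proj v a = proj v a') (hd : proj v a = v → d ≠ x) : a = a' := by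
  match a, a' with
  | none, none => rfl
  | none, some u =>
    obtain rfl : v = u := hp
    exact (h.elim (h' rfl) (hd rfl)).elim
  | some u, none =>
    obtain rfl : u = v := hp
    exact (h'.elim (h rfl) (hd rfl)).elim
  | some u, some u' => exact congrArg some hp

theorem exists_attached (v : V) (x : Letter n × V) (X : Set (Letter n × V)) (u : V)
    (d : Letter n × V) : ∃ a, proj v a = u ∧ Attached v x X a d := by
  by_cases h : u = v ∧ d ∈ X
  · exact ⟨none, h.1.symm, Or.inl h.2⟩
  · exact ⟨some u, rfl, fun h1 h2 => h ⟨h1, h2⟩⟩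

theorem attached_self (hxX : x ∉ X) (a : Option V) : Attached v x X a x := by
  cases a with
  | none => exact Or.inr rfl
  | some u => exact fun _ => hxX

/-- The graph obtained from `Δ` by unfolding at the direction `x` at `v`: the vertex `v` is divided
in two, each part keeps a copy of the edge `x`, and the other directions are distributed according
to whether they belong to `X`. -/
def LabelledGraph.unfold (Δ : LabelledGraph n V) (v : V) (x : Letter n × V)
    (X : Set (Letter n × V)) : LabelledGraph n (Option V) where
  Edge s a b := Δ.Edge s (proj v a) (proj v b) ∧ Attached v x X a (s, proj v b) ∧
    Attached v x X b (s.inv, proj v a)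
  symm s a b h := ⟨Δ.symm h.1, h.2.2, by simpa only [Letter.inv_inv] using h.2.1⟩

/-- The folding map, induced by `proj`, on the vertices of the covers. -/
def foldVert (v : V) (y : Vert n (Option V)) : Vert n V := ⟨y.base, proj v y.label⟩

section Cover

variable {Δ : LabelledGraph n V} {y y' z z' : Vert n (Option V)}

theorem adj_foldVert (h : (Δ.unfold v x X).cover.Adj y z) :
    Δ.cover.Adj (foldVert v y) (foldVert v z) := by
  obtain ⟨s, hs, hE⟩ := h
  exact ⟨s, hs, hE.1⟩

theorem attached_of_adj (h : (Δ.unfold v x X).cover.Adj y z)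
    (hd : foldVert v z = (foldVert v y).next d) : Attached v x X y.label d := by
  obtain ⟨s, hs, hE⟩ := h
  have hs' : (foldVert v y).next (s, proj v z.label) = foldVert v z := Vert.ext hs.symm rfl
  rw [← (foldVert v y).next_injective (hs'.trans hd)]
  exact hE.2.1

theorem eq_of_attached (hz : foldVert v y = foldVert v z) (h : Attached v x X y.label d)
    (h' : Attached v x X z.label d) (hd : (foldVert v z).label = v → d ≠ x) : y = z := by
  have hlabel : proj v y.label = proj v z.label := congrArg Vert.label hz
  exact Vert.ext (show (foldVert v y).base = _ from congrArg Vert.base hz)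
    (h.unique h' hlabel fun hv => hd (hlabel.symm.trans hv))

/-- The step from `y` to `z` passes over the edge `x`, of which the unfolded graph has two
copies. -/
def PassesOver (v : V) (x : Letter n × V) (y z : Vert n V) : Prop := y.label = v ∧ z = y.next x

theorem PassesOver.not_swap {y z : Vert n V} (h : PassesOver v x y z) : ¬ PassesOver v x z y := by
  rintro ⟨-, hy⟩
  have hbase : ofLetter x.1 * ofLetter x.1 = 1 := by
    have := congrArg Vert.base hy
    rwa [h.2, Vert.next, Vert.next, mul_assoc, left_eq_mul] at this
  exact Letter.inv_ne x.1 (ofLetter_injective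
    ((ofLetter_inv x.1).trans (inv_eq_of_mul_eq_one_left hbase)))

theorem eq_of_foldVert_eq (h : (Δ.unfold v x X).cover.Adj y y')
    (h' : (Δ.unfold v x X).cover.Adj z z') (hz : foldVert v y = foldVert v z)
    (hz' : foldVert v y' = foldVert v z')
    (hx : ¬ PassesOver v x (foldVert v z) (foldVert v z')) : y = z := by
  obtain ⟨d, -, hd⟩ := LabelledGraph.exists_eq_next (adj_foldVert h')
  refine eq_of_attached hz (attached_of_adj h ?_) (attached_of_adj h' hd) fun hv hdx => ?_
  · rw [hz', hz, hd]
  · exact hx ⟨hv, hdx ▸ hd⟩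

theorem exists_adj_unfold {w w' : Vert n V} (h : Δ.cover.Adj w w') :
    ∃ y z, foldVert v y = w ∧ foldVert v z = w' ∧ (Δ.unfold v x X).cover.Adj y z := by
  obtain ⟨s, hs, hE⟩ := h
  obtain ⟨a, ha, hA⟩ := exists_attached v x X w.label (s, w'.label)
  obtain ⟨b, hb, hB⟩ := exists_attached v x X w'.label (s.inv, w.label)
  refine ⟨⟨w.base, a⟩, ⟨w'.base, b⟩, Vert.ext rfl ha, Vert.ext rfl hb, s, hs, ?_⟩
  exact ⟨by rwa [ha, hb], by rwa [hb], by rwa [ha]⟩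

theorem reachable_of_foldVert_eq (hx : x ∈ Δ.directions v) (hxX : x ∉ X)
    (h : foldVert v y = foldVert v z) : (Δ.unfold v x X).cover.Reachable y z := by
  by_cases hv : (foldVert v y).label = v
  · obtain ⟨b, hb, hB⟩ := exists_attached v x X x.2 (x.1.inv, v)
    have hadj : ∀ w, foldVert v w = foldVert v y →
        (Δ.unfold v x X).cover.Adj w ⟨y.base * ofLetter x.1, b⟩ := fun w hw => by
      have hlabel : proj v w.label = v := (congrArg Vert.label hw).trans hv
      refine ⟨x.1, congrArg (· * _) (congrArg Vert.base hw).symm, ?_, ?_, ?_⟩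
      · rwa [hlabel, hb]
      · rw [hb]
        exact attached_self hxX w.label
      · rwa [hlabel]
    exact (hadj y rfl).reachable.trans (hadj z h.symm).symm.reachable
  · rw [eq_of_attached h (attached_self hxX y.label) (attached_self hxX z.label)
      fun hz => (hv (h ▸ hz)).elim]

theorem preconnected_unfold (hΔ : Δ.cover.Preconnected) (hx : x ∈ Δ.directions v) (hxX : x ∉ X) :
    (Δ.unfold v x X).cover.Preconnected := fun y z => by
  refine forall_of_forall_adj hΔ
    (p := fun w => ∀ z, foldVert v z = w → (Δ.unfold v x X).cover.Reachable y z) (x := foldVert v y)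
    (fun z hz => reachable_of_foldVert_eq hx hxX hz.symm) (fun w w' hw ih z hz => ?_) _ z rfl
  obtain ⟨a, b, ha, hb, hab⟩ := exists_adj_unfold (v := v) (x := x) (X := X) hw
  exact ((ih a ha).trans hab.reachable).trans
    (reachable_of_foldVert_eq hx hxX (hb.trans hz.symm))

end Cover

section Acyclic

variable {T : LabelledTree n V} {y z z' : Vert n (Option V)} {H : Set (Vert n V)}

theorem isHalfSpace_preimage_foldVert (h : (T.unfold v x X).cover.Adj z z')
    (hx : ¬ PassesOver v x (foldVert v z) (foldVert v z'))
    (hx' : ¬ PassesOver v x (foldVert v z') (foldVert v z))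
    (hH : IsHalfSpace T.cover (foldVert v z) (foldVert v z') H) :
    IsHalfSpace (T.unfold v x X).cover z z' (foldVert v ⁻¹' H) where
  notMem := hH.notMem
  mem := hH.mem
  eq_of_adj y y' hyy' hy hy' := by
    obtain ⟨hyz, hyz'⟩ := hH.eq_of_adj (adj_foldVert hyy') hy hy'
    exact ⟨eq_of_foldVert_eq hyy' h hyz hyz' hx, eq_of_foldVert_eq hyy'.symm h.symm hyz' hyz hx'⟩

/-- The part of the unfolded tree behind `z` when one looks from `z` along its copy of the edge
`x`. -/
def cutSide (T : LabelledTree n V) (v : V) (x : Letter n × V) (X : Set (Letter n × V))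
    (z : Vert n (Option V)) : Set (Vert n (Option V)) :=
  {y | y = z ∨ ∃ d ∈ T.directions v, d ≠ x ∧ Attached v x X z.label d ∧
    foldVert v y ∈ T.halfSpaceAt (foldVert v z) d}

theorem mem_cutSide_of_adj (h : (T.unfold v x X).cover.Adj z y) (hv : (foldVert v z).label = v)
    (hx : ¬ PassesOver v x (foldVert v z) (foldVert v y)) : y ∈ cutSide T v x X z := by
  obtain ⟨d, hd, hy⟩ := LabelledGraph.exists_eq_next (adj_foldVert h)
  refine Or.inr ⟨d, hv ▸ hd, fun hdx => hx ⟨hv, hdx ▸ hy⟩, attached_of_adj h hy, ?_⟩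
  rw [hy]
  exact (LabelledTree.isHalfSpace_halfSpaceAt hd).mem

theorem isHalfSpace_cutSide (h : (T.unfold v x X).cover.Adj z z')
    (hx : PassesOver v x (foldVert v z) (foldVert v z')) :
    IsHalfSpace (T.unfold v x X).cover z' z (cutSide T v x X z) where
  mem := Or.inl rfl
  notMem := by
    rintro (rfl | ⟨d, hd, hdx, -, hz'⟩)
    · exact h.ne rfl
    · have hH := LabelledTree.isHalfSpace_halfSpaceAt (z := foldVert v z) (hx.1.symm ▸ hd)
      have hnext := (hH.eq_of_adj (adj_foldVert h) hH.notMem hz').2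
      exact hdx ((foldVert v z).next_injective (hnext.symm.trans hx.2))
  eq_of_adj y y' hyy' hy hy' := by
    rcases hy' with rfl | ⟨d, hd, hdx, hA, hy'⟩
    · have hyx : PassesOver v x (foldVert v y') (foldVert v y) :=
        by_contra fun hyx => hy (mem_cutSide_of_adj hyy'.symm hx.1 hyx)
      exact ⟨eq_of_foldVert_eq hyy' h.symm (hyx.2.trans hx.2.symm) rfl hx.not_swap, rfl⟩
    · have hH := LabelledTree.isHalfSpace_halfSpaceAt (z := foldVert v z) (hx.1.symm ▸ hd)
      obtain ⟨hyz, hnext⟩ := hH.eq_of_adj (adj_foldVert hyy')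
        (fun hyH => hy (Or.inr ⟨d, hd, hdx, hA, hyH⟩)) hy'
      have hAy := attached_of_adj hyy' (hnext.trans (congrArg (Vert.next · d) hyz.symm))
      exact (hy (Or.inl (eq_of_attached hyz hAy hA fun _ => hdx))).elim

theorem isAcyclic_unfold : (T.unfold v x X).cover.IsAcyclic := by
  refine isAcyclic_of_exists_isHalfSpace fun z z' h => ?_
  by_cases hx : PassesOver v x (foldVert v z) (foldVert v z')
  · exact ⟨_, (isHalfSpace_cutSide h hx).compl⟩
  by_cases hx' : PassesOver v x (foldVert v z') (foldVert v z)
  · exact ⟨_, isHalfSpace_cutSide h.symm hx'⟩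
  exact ⟨_, isHalfSpace_preimage_foldVert h hx hx'
    (isHalfSpace_halfSpace T.isTree.isAcyclic (adj_foldVert h))⟩

end Acyclic

/-- Unfolding a labelled tree, see `LabelledGraph.unfold`. -/
def LabelledTree.unfold (T : LabelledTree n V) (hx : x ∈ T.directions v) (hxX : x ∉ X) :
    LabelledTree n (Option V) where
  toLabelledGraph := T.toLabelledGraph.unfold v x X
  isTree :=
    { preconnected := preconnected_unfold T.isTree.connected.preconnected hx hxX
      nonempty := ⟨⟨1, none⟩⟩
      isAcyclic := isAcyclic_unfold }

end Unfold

section UnfoldLineMap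

variable {n : ℕ} {V : Type*} {T : LabelledTree n V} {B : Set (Line n)} {v : V} {x : Letter n × V}
  {X : Set (Letter n × V)} {p : Boundary n × Boundary n}

namespace LineMap

/-- A line through `v` that uses a direction of `X` uses `x` or a second direction of `X`. This is
what allows the lines to be lifted to the tree unfolded at `x`. -/
def TurnsWithin (φ : LineMap T B) (v : V) (x : Letter n × V) (X : Set (Letter n × V)) : Prop :=
  ∀ p ∈ lifts B, Pointed p → φ.lam p = v → φ.dir p ∈ X → φ.dir p.swap ∈ X ∨ φ.dir p.swap = x

variable (φ : LineMap T B)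

variable (v X) in
open Classical in
/-- The values of `LineMap.unfold`. -/
noncomputable def unfoldLam (p : Boundary n × Boundary n) : Option V :=
  if φ.lam p = v ∧ (φ.dir p ∈ X ∨ φ.dir p.swap ∈ X) then none else some (φ.lam p)

theorem proj_unfoldLam : proj v (φ.unfoldLam v X p) = φ.lam p := by
  unfold unfoldLam
  split_ifs with h
  · exact h.1.symm
  · rfl

theorem unfoldLam_swap (hp : p ∈ lifts B) (h : Pointed p) :
    φ.unfoldLam v X p.swap = φ.unfoldLam v X p := by
  unfold unfoldLam
  rw [φ.lam_swap p hp h, Prod.swap_swap]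
  split_ifs <;> tauto

variable {φ}

theorem TurnsWithin.swap (hturn : φ.TurnsWithin v x X) (hp : p ∈ lifts B) (h : Pointed p)
    (hv : φ.lam p = v) (hX : φ.dir p.swap ∈ X) : φ.dir p ∈ X ∨ φ.dir p = x := by
  have hswap := hturn p.swap (swap_mem_lifts hp) h.swap (by rwa [φ.lam_swap p hp h]) hX
  rwa [Prod.swap_swap] at hswap

theorem TurnsWithin.attached_dir (hturn : φ.TurnsWithin v x X) (hp : p ∈ lifts B) (h : Pointed p) :
    Attached v x X (φ.unfoldLam v X p) (φ.dir p) := by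
  unfold unfoldLam
  split_ifs with hX
  · exact hX.2.elim Or.inl (hturn.swap hp h hX.1)
  · exact fun hv hd => hX ⟨hv, Or.inl hd⟩

variable (φ) in
/-- The lift of a line map to the unfolded tree. -/
noncomputable def unfold (hx : x ∈ T.directions v) (hxX : x ∉ X) (hturn : φ.TurnsWithin v x X) :
    LineMap (T.unfold hx hxX) B where
  lam := φ.unfoldLam v X
  lam_swap _ hp h := φ.unfoldLam_swap hp h
  edge p hp h := by
    refine ⟨?_, ?_, ?_⟩
    · rw [φ.proj_unfoldLam, φ.proj_unfoldLam]
      exact φ.edge p hp h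
    · rw [φ.proj_unfoldLam]
      exact hturn.attached_dir hp h
    · rw [φ.proj_unfoldLam, ← φ.dir_swap_step hp h, ← φ.unfoldLam_swap (step_mem_lifts hp) h.step]
      exact hturn.attached_dir (swap_mem_lifts (step_mem_lifts hp)) h.step.swap

variable {d d' : Letter n × V}

theorem Crosses.exists_unfoldLam_eq_none (hd : d ∈ X) (h : φ.Crosses B v d) :
    ∃ p ∈ lifts B, Pointed p ∧ φ.unfoldLam v X p = none := by
  obtain ⟨p, hp, hpp, hv, rfl⟩ := h
  exact ⟨p, hp, hpp, if_pos ⟨hv, Or.inl hd⟩⟩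

theorem TurnsWithin.exists_unfoldLam_eq_some (hturn : φ.TurnsWithin v x X) (hd : d ∉ X)
    (hdx : d ≠ x) (h : φ.Crosses B v d) :
    ∃ p ∈ lifts B, Pointed p ∧ φ.unfoldLam v X p = some v := by
  obtain ⟨p, hp, hpp, rfl, rfl⟩ := h
  exact ⟨p, hp, hpp, if_neg fun hX => hX.2.elim hd fun hswap =>
    (hturn.swap hp hpp rfl hswap).elim hd hdx⟩

theorem TurnsWithin.unfold_visited (hturn : φ.TurnsWithin v x X)
    (hvis : ∀ u, ∃ p ∈ lifts B, Pointed p ∧ φ.lam p = u) (hd : d ∈ X) (hcross : φ.Crosses B v d)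
    (hd' : d' ∉ X) (hdx' : d' ≠ x) (hcross' : φ.Crosses B v d') (a : Option V) :
    ∃ p ∈ lifts B, Pointed p ∧ φ.unfoldLam v X p = a := by
  cases a with
  | none => exact hcross.exists_unfoldLam_eq_none hd
  | some u =>
    by_cases hu : u = v
    · exact hu ▸ hturn.exists_unfoldLam_eq_some hd' hdx' hcross'
    · obtain ⟨p, hp, hpp, rfl⟩ := hvis u
      exact ⟨p, hp, hpp, if_neg fun h => hu h.1⟩

end LineMap

end UnfoldLineMap

section Darts

variable {n : ℕ} {V : Type*}

/-- The oriented edges of a labelled graph, as pairs of a vertex and a direction there. -/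
def LabelledGraph.Dart (Δ : LabelledGraph n V) : Type _ :=
  {q : V × (Letter n × V) // q.2 ∈ Δ.directions q.1}

namespace LabelledGraph.Dart

variable {Δ : LabelledGraph n V}

instance [Finite V] : Finite Δ.Dart :=
  inferInstanceAs (Finite {q : V × (Letter n × V) // q.2 ∈ Δ.directions q.1})

/-- The dart with the opposite orientation. -/
def reverse (q : Δ.Dart) : Δ.Dart := ⟨(q.1.2.2, q.1.2.1.inv, q.1.1), Δ.symm q.2⟩

theorem reverse_reverse (q : Δ.Dart) : q.reverse.reverse = q :=
  Subtype.ext (Prod.ext rfl (Prod.ext q.1.2.1.inv_inv rfl))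

variable {v : V} {x : Letter n × V} {X : Set (Letter n × V)} {q q' : (Δ.unfold v x X).Dart}

/-- The dart of `Δ` that is unfolded to `q`. -/
def fold (q : (Δ.unfold v x X).Dart) : Δ.Dart :=
  ⟨(proj v q.1.1, q.1.2.1, proj v q.1.2.2), q.2.1⟩

/-- The copy of the edge `x` at the new vertex, oriented away from it. -/
def IsNew (q : (Δ.unfold v x X).Dart) : Prop := q.1.1 = none ∧ q.fold.1.2 = x

theorem IsNew.not_reverse (h : q.IsNew) : ¬ q.reverse.IsNew := fun h' =>
  Letter.inv_ne q.1.2.1 (congrArg Prod.fst (h'.2.trans h.2.symm))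

theorem fst_eq_of_fold_eq (hf : q.fold = q'.fold) (h : ¬ q.IsNew) (h' : ¬ q'.IsNew) :
    q.1.1 = q'.1.1 := by
  have hproj : proj v q.1.1 = proj v q'.1.1 := congrArg (·.1.1) hf
  have hdir : q.fold.1.2 = q'.fold.1.2 := congrArg (·.1.2) hf
  by_cases hx : q.fold.1.2 = x
  · obtain ⟨u, hu⟩ := Option.ne_none_iff_exists'.mp fun hnone => h ⟨hnone, hx⟩
    obtain ⟨u', hu'⟩ := Option.ne_none_iff_exists'.mp fun hnone => h' ⟨hnone, hdir ▸ hx⟩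
    rw [hu, hu'] at hproj ⊢
    exact congrArg some hproj
  · exact q.2.2.1.unique (show Attached v x X q'.1.1 q.fold.1.2 from hdir ▸ q'.2.2.1) hproj
      fun _ => hx

theorem eq_of_fold_eq (hf : q.fold = q'.fold) (hfst : q.1.1 = q'.1.1)
    (hsnd : q.reverse.1.1 = q'.reverse.1.1) : q = q' :=
  Subtype.ext (Prod.ext hfst (Prod.ext (congrArg (·.1.2.1) hf) hsnd))

theorem fold_reverse_eq (hf : q.fold = q'.fold) : q.reverse.fold = q'.reverse.fold :=
  congrArg reverse hf

theorem subsingleton_isNew : {q : (Δ.unfold v x X).Dart | q.IsNew}.Subsingleton := by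
  intro q h q' h'
  have hf : q.fold = q'.fold := Subtype.ext <|
    Prod.ext (congrArg (proj v) (h.1.trans h'.1.symm)) (h.2.trans h'.2.symm)
  exact eq_of_fold_eq hf (h.1.trans h'.1.symm)
    (fst_eq_of_fold_eq (fold_reverse_eq hf) h.not_reverse h'.not_reverse)

theorem subsingleton_isNew_reverse :
    {q : (Δ.unfold v x X).Dart | q.reverse.IsNew}.Subsingleton :=
  subsingleton_isNew.preimage (Function.LeftInverse.injective reverse_reverse)

theorem injOn_fold : Set.InjOn (fold (Δ := Δ) (v := v) (x := x) (X := X))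
    ({q | q.IsNew} ∪ {q | q.reverse.IsNew})ᶜ := by
  intro q h q' h' hf
  exact eq_of_fold_eq hf (fst_eq_of_fold_eq hf (fun hq => h (Or.inl hq)) fun hq => h' (Or.inl hq))
    (fst_eq_of_fold_eq (fold_reverse_eq hf) (fun hq => h (Or.inr hq)) fun hq => h' (Or.inr hq))

theorem card_unfold_le [Finite V] :
    Nat.card (Δ.unfold v x X).Dart ≤ Nat.card Δ.Dart + 2 := by
  let S : Set (Δ.unfold v x X).Dart := {q | q.IsNew} ∪ {q | q.reverse.IsNew}
  have hnew : S.ncard ≤ 1 + 1 := (Set.ncard_union_le _ _).trans <|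
    add_le_add (Set.ncard_le_one_iff_subsingleton.mpr subsingleton_isNew)
      (Set.ncard_le_one_iff_subsingleton.mpr subsingleton_isNew_reverse)
  have hold : Sᶜ.ncard ≤ Nat.card Δ.Dart := by
    rw [← Set.ncard_univ]
    exact Set.ncard_le_ncard_of_injOn fold (fun _ _ => Set.mem_univ _) injOn_fold
  rw [← Set.ncard_add_ncard_compl S]
  omega

end LabelledGraph.Dart

end Darts

section Cayley

variable {n : ℕ}

/-- The graph with one vertex and one loop for each generator. -/
def rose (n : ℕ) : LabelledGraph n Unit where
  Edge _ _ _ := True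
  symm _ _ _ _ := trivial

theorem preconnected_cover_rose : (rose n).cover.Preconnected := by
  rintro ⟨g, ⟨⟩⟩ ⟨h, ⟨⟩⟩
  have hreach : ∀ y, (rose n).cover.Reachable ⟨g, ()⟩ ⟨g * y, ()⟩ := fun y => by
    induction y using mul_ofLetter_induction with
    | one => rw [mul_one]
    | mul_ofLetter y s ih =>
      exact ih.trans (SimpleGraph.Adj.reachable ⟨s, (mul_assoc g y _).symm, trivial⟩)
  simpa only [mul_inv_cancel_left] using hreach (g⁻¹ * h)

theorem eq_one_of_head?_toWord {w : FreeGroup (Fin n)} {s t : Letter n}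
    (h : w.toWord.head? ≠ some s) (ht : (w * ofLetter t).toWord.head? = some s) :
    w = 1 ∧ t = s := by
  rcases toWord_mul_ofLetter w t with hw | hw
  · have hnil : w.toWord = [] := by
      by_contra hne
      rw [hw, List.head?_append_of_ne_nil _ hne] at ht
      exact h ht
    rw [hw, hnil] at ht
    exact ⟨FreeGroup.toWord_eq_nil_iff.mp hnil, Option.some.inj ht⟩
  · rw [hw, List.head?_append, ht] at h
    exact (h rfl).elim

theorem isAcyclic_cover_rose : (rose n).cover.IsAcyclic := by
  refine isAcyclic_of_exists_isHalfSpace ?_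
  rintro ⟨g, ⟨⟩⟩ ⟨_, ⟨⟩⟩ ⟨s, rfl, -⟩
  refine ⟨{y | (g⁻¹ * y.base).toWord.head? = some s}, by simp, by simp [toWord_ofLetter], ?_⟩
  rintro ⟨y, ⟨⟩⟩ ⟨_, ⟨⟩⟩ ⟨t, rfl, -⟩ hy ht
  rw [Set.mem_ofPred_eq, ← mul_assoc] at ht
  obtain ⟨hgy, rfl⟩ := eq_one_of_head?_toWord hy ht
  obtain rfl := inv_mul_eq_one.mp hgy
  exact ⟨rfl, rfl⟩

/-- The Cayley tree of the free group. -/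
def cayleyTree (n : ℕ) : LabelledTree n Unit where
  toLabelledGraph := rose n
  isTree :=
    { preconnected := preconnected_cover_rose
      nonempty := ⟨⟨1, ()⟩⟩
      isAcyclic := isAcyclic_cover_rose }

end Cayley

section Resolution

variable {n : ℕ} {B : Set (Line n)}

/-- A finite graph obtained from the rose by unfolding, which the lines of `B` still lift to. The
bound `card_le` says that its rank is at most `n`. -/
structure Resolution (n : ℕ) (B : Set (Line n)) where
  V : Type
  finite : Finite V
  tree : LabelledTree n V
  map : LineMap tree B
  visited : ∀ v, ∃ p ∈ lifts B, Pointed p ∧ map.lam p = v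
  card_le : Nat.card tree.Dart + 2 ≤ 2 * Nat.card V + 2 * n

attribute [instance] Resolution.finite

instance (R : Resolution n B) : Nonempty R.V := R.tree.nonempty

theorem card_dart_rose_le : Nat.card (rose n).Dart ≤ 2 * n := by
  have hle : Nat.card (rose n).Dart ≤ Nat.card (Unit × Letter n × Unit) :=
    Nat.card_le_card_of_injective _ Subtype.val_injective
  simpa [mul_comm] using hle

theorem exists_resolution (hB : B.Nonempty) : ∃ R : Resolution n B, Nat.card R.V = 1 := by
  obtain ⟨ℓ, hℓ⟩ := hB
  obtain ⟨p, hp, hpp, -⟩ := exists_pointed_mem_lifts hℓ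
  refine ⟨
    { V := Unit
      finite := inferInstance
      tree := cayleyTree n
      map := ⟨fun _ => (), fun _ _ _ => rfl, fun _ _ _ => trivial⟩
      visited := fun _ => ⟨p, hp, hpp, rfl⟩
      card_le := ?_ }, Nat.card_unique⟩
  have := card_dart_rose_le (n := n)
  change Nat.card (rose n).Dart + 2 ≤ _
  rw [Nat.card_unique (α := Unit)]
  omega

namespace Resolution

/-- The lines of `B` connect the directions at each vertex even after one of them is removed. -/
def NoCut (R : Resolution n B) : Prop :=
  ∀ v, ∀ x ∈ R.tree.directions v, ∀ X : Set (Letter n × R.V), x ∉ X →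
    (X ∩ R.tree.directions v).Nonempty → (R.tree.directions v \ insert x X).Nonempty →
    ¬ R.map.TurnsWithin v x X

theorem exists_succ (R : Resolution n B)
    (hcross : ∀ v, ∀ d ∈ R.tree.directions v, R.map.Crosses B v d) (h : ¬ R.NoCut) :
    ∃ R' : Resolution n B, Nat.card R'.V = Nat.card R.V + 1 := by
  unfold NoCut at h
  push Not at h
  obtain ⟨v, x, hx, X, hxX, ⟨d, hd, hdv⟩, ⟨d', hdv', hd'⟩, hturn⟩ := h
  have hcard : Nat.card (Option R.V) = Nat.card R.V + 1 := Finite.card_option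
  refine ⟨
    { V := Option R.V
      finite := inferInstance
      tree := R.tree.unfold hx hxX
      map := R.map.unfold hx hxX hturn
      visited := hturn.unfold_visited R.visited hd (hcross v d hdv)
        (fun hX => hd' (Or.inr hX)) (fun hdx => hd' (Or.inl hdx)) (hcross v d' hdv')
      card_le := ?_ }, hcard⟩
  have hdart : Nat.card (R.tree.unfold hx hxX).Dart ≤ Nat.card R.tree.Dart + 2 :=
    LabelledGraph.Dart.card_unfold_le
  have := R.card_le
  omega

end Resolution

end Resolution

section Counting

variable {n : ℕ}

/-- A bound for `Resolution.nearBranch`. -/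
def branchBound (n : ℕ) : ℕ → ℕ
  | 0 => 2 * n
  | i + 1 => 3 * branchBound n i + 2 * n

namespace Resolution

variable {B : Set (Line n)} (R : Resolution n B)

noncomputable instance : Fintype R.V := Fintype.ofFinite _

/-- The number of directions at a vertex. -/
noncomputable def deg (v : R.V) : ℕ := (R.tree.directions v).ncard

theorem two_le_deg (v : R.V) : 2 ≤ R.deg v := by
  obtain ⟨p, hp, hpp, rfl⟩ := R.visited v
  exact (Set.one_lt_ncard (Set.toFinite _)).mpr ⟨_, R.map.dir_mem hp hpp, _,
    R.map.dir_swap_mem hp hpp, R.map.dir_ne_dir_swap hpp⟩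

theorem sum_deg : ∑ v, R.deg v = Nat.card R.tree.Dart := by
  simp only [deg, ← Nat.card_coe_set_eq]
  rw [← Nat.card_sigma]
  exact Nat.card_congr
    { toFun := fun q => ⟨(q.1, q.2.1), q.2.2⟩
      invFun := fun q => ⟨q.1.1, ⟨q.1.2, q.2⟩⟩ }

theorem sum_deg_le (S : Finset R.V) : ∑ v ∈ S, R.deg v ≤ 2 * S.card + 2 * n := by
  classical
  have hsum : ∑ v ∈ S, R.deg v + ∑ v ∈ Sᶜ, R.deg v = Nat.card R.tree.Dart := by
    rw [Finset.sum_add_sum_compl, R.sum_deg]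
  have hcompl : Sᶜ.card * 2 ≤ ∑ v ∈ Sᶜ, R.deg v :=
    Finset.card_nsmul_le_sum _ _ _ fun v _ => R.two_le_deg v
  have hcard : S.card + Sᶜ.card = Nat.card R.V := by
    rw [Finset.card_add_card_compl, Nat.card_eq_fintype_card]
  have := R.card_le
  omega

/-- The neighbours of a vertex in the quotient graph. -/
noncomputable def neighbors (v : R.V) : Finset R.V :=
  (Set.toFinite (Prod.snd '' R.tree.directions v)).toFinset

theorem mem_neighbors {v w : R.V} : w ∈ R.neighbors v ↔ ∃ d ∈ R.tree.directions v, d.2 = w := by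
  simp only [neighbors, Set.Finite.mem_toFinset, Set.mem_image]

theorem card_neighbors_le (v : R.V) : (R.neighbors v).card ≤ R.deg v := by
  rw [neighbors, ← Set.ncard_eq_toFinset_card]
  exact Set.ncard_image_le

open Classical in
/-- The vertices within distance `i` of a vertex with more than two directions. -/
noncomputable def nearBranch : ℕ → Finset R.V
  | 0 => {v | R.deg v ≠ 2}
  | i + 1 => nearBranch i ∪ (nearBranch i).biUnion R.neighbors

theorem card_nearBranch_le (i : ℕ) : (R.nearBranch i).card ≤ branchBound n i := by
  classical
  induction i with
  | zero =>
    have hsum := R.sum_deg_le (R.nearBranch 0)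
    have hdeg : (R.nearBranch 0).card * 3 ≤ ∑ v ∈ R.nearBranch 0, R.deg v := by
      refine Finset.card_nsmul_le_sum (R.nearBranch 0) R.deg 3 fun v hv => ?_
      have hv : R.deg v ≠ 2 := by simpa only [nearBranch, Finset.mem_filter_univ] using hv
      exact (R.two_le_deg v).lt_of_ne' hv
    rw [branchBound]
    omega
  | succ i ih =>
    have hsum := R.sum_deg_le (R.nearBranch i)
    have hneighbors : ((R.nearBranch i).biUnion R.neighbors).card ≤ ∑ v ∈ R.nearBranch i, R.deg v :=
      Finset.card_biUnion_le.trans (Finset.sum_le_sum fun v _ => R.card_neighbors_le v)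
    calc (R.nearBranch (i + 1)).card
        ≤ (R.nearBranch i).card + ((R.nearBranch i).biUnion R.neighbors).card :=
          Finset.card_union_le _ _
      _ ≤ 3 * (R.nearBranch i).card + 2 * n := by omega
      _ ≤ 3 * branchBound n i + 2 * n := by
          omega

variable {R} {i : ℕ} {v w : R.V}

theorem deg_eq_two_of_notMem_nearBranch (h : v ∉ R.nearBranch i) : R.deg v = 2 := by
  classical
  induction i with
  | zero => simpa [nearBranch] using h
  | succ i ih => exact ih fun hv => h (Finset.mem_union_left _ hv)

theorem snd_notMem_nearBranch {d : Letter n × R.V} (h : v ∉ R.nearBranch (i + 1))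
    (hd : d ∈ R.tree.directions v) : d.2 ∉ R.nearBranch i := by
  classical
  intro hi
  exact h (Finset.mem_union_right _ (Finset.mem_biUnion.mpr
    ⟨d.2, hi, R.mem_neighbors.mpr ⟨(d.1.inv, v), R.tree.symm hd, rfl⟩⟩))

variable {p p' : Boundary n × Boundary n}

theorem dir_swap_eq_of_deg_eq_two (hp : p ∈ lifts B) (hpp : Pointed p) (hp' : p' ∈ lifts B)
    (hpp' : Pointed p') (hlam : R.map.lam p = R.map.lam p') (hdir : R.map.dir p = R.map.dir p')
    (hdeg : R.deg (R.map.lam p) = 2) : R.map.dir p.swap = R.map.dir p'.swap := by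
  obtain ⟨d, d', -, hd⟩ := Set.ncard_eq_two.mp hdeg
  have h₀ := R.map.dir_mem hp hpp
  have h₁ := R.map.dir_swap_mem hp hpp
  have h₂ := R.map.dir_swap_mem hp' hpp'
  have hne := R.map.dir_ne_dir_swap hpp
  have hne' := R.map.dir_ne_dir_swap hpp'
  rw [← hlam] at h₂
  rw [← hdir] at hne'
  simp only [hd, Set.mem_insert_iff, Set.mem_singleton_iff] at h₀ h₁ h₂
  grind

theorem dir_step_eq_of_deg_eq_two (hp : p ∈ lifts B) (hpp : Pointed p) (hp' : p' ∈ lifts B)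
    (hpp' : Pointed p') (hlam : R.map.lam p = R.map.lam p') (hdir : R.map.dir p = R.map.dir p')
    (hdeg : R.deg (R.map.lam (step p)) = 2) : R.map.dir (step p) = R.map.dir (step p') := by
  have hstep := step_mem_lifts hp
  have hstep' := step_mem_lifts hp'
  have hswap := R.map.lam_swap _ hstep hpp.step
  have hswap' := R.map.lam_swap _ hstep' hpp'.step
  refine dir_swap_eq_of_deg_eq_two (swap_mem_lifts hstep) hpp.step.swap (swap_mem_lifts hstep')
    hpp'.step.swap ?_ ?_ (by rwa [hswap])
  · rw [hswap, hswap']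
    exact congrArg Prod.snd hdir
  · rw [R.map.dir_swap_step hp hpp, R.map.dir_swap_step hp' hpp', hlam]
    exact congrArg (fun d => (d.1.inv, R.map.lam p')) hdir

theorem apply_eq_of_notMem_nearBranch (hp : p ∈ lifts B) (hpp : Pointed p) (hp' : p' ∈ lifts B)
    (hpp' : Pointed p') (hlam : R.map.lam p = R.map.lam p') (hdir : R.map.dir p = R.map.dir p')
    (h : R.map.lam p ∉ R.nearBranch i) : ∀ j ≤ i, p.1.1 j = p'.1.1 j := by
  have hzero : p.1.1 0 = p'.1.1 0 := congrArg Prod.fst hdir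
  induction i generalizing p p' with
  | zero => exact fun j hj => by rwa [Nat.le_zero.mp hj]
  | succ i ih =>
    have hw := snd_notMem_nearBranch h (R.map.dir_mem hp hpp)
    have hdir' := dir_step_eq_of_deg_eq_two hp hpp hp' hpp' hlam hdir
      (deg_eq_two_of_notMem_nearBranch hw)
    rintro (_ | j) hj
    · exact hzero
    · rw [← step_fst_apply, ← step_fst_apply]
      exact ih (step_mem_lifts hp) hpp.step (step_mem_lifts hp') hpp'.step
        (congrArg Prod.snd hdir) hdir' hw (congrArg Prod.fst hdir') j (Nat.le_of_succ_le_succ hj)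

variable {B₁ B₂ : Set (Line n)}

theorem exists_agree (h₁ : B₁ ⊆ B) (h₂ : B₂ ⊆ B)
    (hcross₁ : ∀ v, ∀ d ∈ R.tree.directions v, R.map.Crosses B₁ v d)
    (hcross₂ : ∀ v, ∀ d ∈ R.tree.directions v, R.map.Crosses B₂ v d) {N : ℕ}
    (hN : branchBound n N < Nat.card R.V) :
    ∃ p ∈ lifts B₁, ∃ p' ∈ lifts B₂, Pointed p ∧
      ∀ i ≤ N, p.1.1 i = p'.1.1 i ∧ p.2.1 i = p'.2.1 i := by
  obtain ⟨v, hv⟩ : ∃ v, v ∉ R.nearBranch N := by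
    by_contra! hall
    have hle := R.card_nearBranch_le N
    rw [Finset.eq_univ_iff_forall.mpr hall, Finset.card_univ, ← Nat.card_eq_fintype_card] at hle
    omega
  obtain ⟨q, hq, hqq, rfl⟩ := R.visited v
  have hd := R.map.dir_mem hq hqq
  obtain ⟨p, hp, hpp, hpv, hpd⟩ := hcross₁ _ _ hd
  obtain ⟨p', hp', hpp', hpv', hpd'⟩ := hcross₂ _ _ hd
  have hpB := lifts_mono h₁ hp
  have hpB' := lifts_mono h₂ hp'
  have hlam := hpv.trans hpv'.symm
  have hdir := hpd.trans hpd'.symm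
  rw [← hpv] at hv
  have hswap := dir_swap_eq_of_deg_eq_two hpB hpp hpB' hpp' hlam hdir
    (deg_eq_two_of_notMem_nearBranch hv)
  refine ⟨p, hp, p', hp', hpp, fun i hi => ⟨?_, ?_⟩⟩
  · exact apply_eq_of_notMem_nearBranch hpB hpp hpB' hpp' hlam hdir hv i hi
  · refine apply_eq_of_notMem_nearBranch (swap_mem_lifts hpB) hpp.swap (swap_mem_lifts hpB')
      hpp'.swap ?_ hswap ?_ i hi
    · rwa [R.map.lam_swap p hpB hpp, R.map.lam_swap p' hpB' hpp']
    · rwa [R.map.lam_swap p hpB hpp]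

end Resolution

end Counting

section Existence

theorem isFreeFactorization_of_unique {G ι : Type*} [Group G] [Unique ι] (A : Subgroup G) :
    IsFreeFactorization A fun _ : ι => A := by
  let π : Monoid.CoprodI (fun _ : ι => A) →* A := Monoid.CoprodI.lift fun _ => MonoidHom.id A
  have hπ : A.subtype.comp π = Monoid.CoprodI.lift fun _ : ι => A.subtype :=
    Monoid.CoprodI.ext_hom _ _ fun i => MonoidHom.ext fun a => by
      simp only [MonoidHom.comp_apply, π, Monoid.CoprodI.lift_of, MonoidHom.id_apply]
  let inc : A →* Monoid.CoprodI (fun _ : ι => A) :=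
    Monoid.CoprodI.of (M := fun _ : ι => A) (i := default)
  have hinv : inc.comp π = MonoidHom.id _ := by
    refine Monoid.CoprodI.ext_hom _ _ fun i => MonoidHom.ext fun a => ?_
    obtain rfl := Unique.eq_default i
    simp only [MonoidHom.comp_apply, π, inc, Monoid.CoprodI.lift_of, MonoidHom.id_apply]
  refine ⟨?_, by rw [Monoid.CoprodI.range_eq_iSup, iSup_unique, Subgroup.range_subtype]⟩
  rw [← hπ, MonoidHom.coe_comp]
  exact A.subtype_injective.comp
    (Function.LeftInverse.injective (g := inc) (DFunLike.congr_fun hinv))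

theorem isFreeFactorSystem_empty {G : Type*} [Group G] :
    IsFreeFactorSystem (∅ : Set (SubgroupClass G)) := by
  refine ⟨⟨Set.finite_empty, fun _ hA => hA.elim⟩, 0, ![], ⊤, by simp, ?_⟩
  convert isFreeFactorization_of_unique (ι := Fin 1) (⊤ : Subgroup G) using 1
  funext i
  induction i using Fin.lastCases with
  | last => exact Fin.snoc_last _ _
  | cast i => exact i.elim0

variable {n : ℕ} {B B₁ B₂ : Set (Line n)}

theorem IsFilling.nonempty (h : IsFilling B) : B.Nonempty := by
  by_contra! hB
  refine conjClass_top_mem_of_isFilling h isFreeFactorSystem_empty fun ℓ hℓ => ?_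
  rw [hB] at hℓ
  exact hℓ.elim

theorem tendsto_boundary_iff {ι : Type*} {l : Filter ι} {f : ι → Boundary n} {ξ : Boundary n} :
    Tendsto f l (𝓝 ξ) ↔ ∀ i, ∀ᶠ k in l, (f k).1 i = ξ.1 i := by
  simp only [tendsto_subtype_rng, tendsto_pi_nhds, nhds_discrete, tendsto_pure]

theorem continuous_line_mk : Continuous (Line.mk : EndpointPair n → Line n) :=
  continuous_quot_mk

theorem line_mk_mem_closure {ι : Type*} {l : Filter ι} [l.NeBot] {p : ι → Boundary n × Boundary n}
    {q : Boundary n × Boundary n} (hp : ∀ k, p k ∈ lifts B) (hq : q.1 ≠ q.2)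
    (h : Tendsto p l (𝓝 q)) : Line.mk ⟨q, hq⟩ ∈ closure B := by
  have hpair : Tendsto (fun k => (⟨p k, (hp k).1⟩ : EndpointPair n)) l (𝓝 ⟨q, hq⟩) :=
    tendsto_subtype_rng.mpr h
  exact mem_closure_of_tendsto ((continuous_line_mk.tendsto _).comp hpair)
    (Eventually.of_forall fun k => (hp k).2)

theorem closure_inter_nonempty
    (h : ∀ N : ℕ, ∃ p ∈ lifts B₁, ∃ p' ∈ lifts B₂, Pointed p ∧
      ∀ i ≤ N, p.1.1 i = p'.1.1 i ∧ p.2.1 i = p'.2.1 i) :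
    (closure B₁ ∩ closure B₂).Nonempty := by
  choose p hp p' hp' hpointed hagree using h
  have : FirstCountableTopology (Boundary n) :=
    Topology.IsInducing.subtypeVal.firstCountableTopology
  obtain ⟨q, φ, hφ, hq⟩ := CompactSpace.tendsto_subseq p
  have hq₁ := tendsto_boundary_iff.mp ((Prod.tendsto_iff _ _).mp hq).1
  have hq₂ := tendsto_boundary_iff.mp ((Prod.tendsto_iff _ _).mp hq).2
  have hlarge : ∀ i, ∀ᶠ k in atTop, i ≤ φ k := hφ.tendsto_atTop.eventually_ge_atTop
  have hq' : Tendsto (p' ∘ φ) atTop (𝓝 q) := by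
    refine (Prod.tendsto_iff _ _).mpr
      ⟨tendsto_boundary_iff.mpr fun i => ?_, tendsto_boundary_iff.mpr fun i => ?_⟩
    · filter_upwards [hq₁ i, hlarge i] with k hk hi
      exact (hagree _ i hi).1.symm.trans hk
    · filter_upwards [hq₂ i, hlarge i] with k hk hi
      exact (hagree _ i hi).2.symm.trans hk
  have hne : q.1 ≠ q.2 := by
    intro he
    obtain ⟨k, hk₁, hk₂⟩ := ((hq₁ 0).and (hq₂ 0)).exists
    exact hpointed (φ k) (hk₁.trans (he ▸ hk₂.symm))
  exact ⟨Line.mk ⟨q, hne⟩, line_mk_mem_closure (fun k => hp (φ k)) hne hq,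
    line_mk_mem_closure (fun k => hp' (φ k)) hne hq'⟩

theorem Resolution.crosses_of_isFilling (R : Resolution n B) (hn : 2 ≤ n) (hB : B₁ ⊆ B)
    (hfill : IsFilling B₁) (v : R.V) (d : Letter n × R.V) (hd : d ∈ R.tree.directions v) :
    R.map.Crosses B₁ v d :=
  R.map.crosses_of_isFilling (z := ⟨1, v⟩) hB hfill hd hn R.visited

theorem exists_noCut (hn : 2 ≤ n) (hB₁ : IsFilling B₁) (hB₂ : IsFilling B₂)
    (hdisj : closure B₁ ∩ closure B₂ = ∅) : ∃ R : Resolution n (B₁ ∪ B₂), R.NoCut := by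
  have hcross₁ := fun R : Resolution n (B₁ ∪ B₂) =>
    R.crosses_of_isFilling hn Set.subset_union_left hB₁
  have hcross₂ := fun R : Resolution n (B₁ ∪ B₂) =>
    R.crosses_of_isFilling hn Set.subset_union_right hB₂
  by_contra! hcut
  have hlarge : ∀ k : ℕ, ∃ R : Resolution n (B₁ ∪ B₂), Nat.card R.V = k + 1 := by
    intro k
    induction k with
    | zero => exact exists_resolution hB₁.nonempty.inl
    | succ k ih =>
      obtain ⟨R, hR⟩ := ih
      obtain ⟨R', hR'⟩ := R.exists_succ (fun v d hd => by
        obtain ⟨p, hp, h⟩ := hcross₁ R v d hd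
        exact ⟨p, lifts_mono Set.subset_union_left hp, h⟩) (hcut R)
      exact ⟨R', by rw [hR', hR]⟩
  refine (closure_inter_nonempty (B₁ := B₁) (B₂ := B₂) fun N => ?_).ne_empty hdisj
  obtain ⟨R, hR⟩ := hlarge (branchBound n N)
  exact R.exists_agree Set.subset_union_left Set.subset_union_right (hcross₁ R) (hcross₂ R)
    (by omega)

end Existence

section NormalForm

variable {ι : Type*} {i j : ι}

section Word

open Monoid.CoprodI

variable {M : ι → Type*} [∀ i, Monoid (M i)]

/-- The index of the factor that contains the last letter of a reduced word in a free product. -/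
def lastIdx (w : Word M) : Option ι :=
  w.toList.getLast?.map Sigma.fst

theorem lastIdx_rcons [∀ i, DecidableEq (M i)] {p : Word.Pair M j}
    (hp : j = i → Word.rcons p ≠ Word.empty) :
    lastIdx (Word.rcons p) = some i ↔
      (p.tail = Word.empty ∧ j = i) ∨ lastIdx p.tail = some i := by
  obtain ⟨m, ⟨l, h₁, h₂⟩, h₃⟩ := p
  by_cases hm : m = 1
  · have : ¬ (l = [] ∧ j = i) := fun h => hp h.2 (by simp [Word.rcons, hm, Word.empty, h.1])
    simp [Word.rcons, hm, lastIdx, Word.empty, this]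
  · rcases List.eq_nil_or_concat l with rfl | ⟨l, x, rfl⟩
    · simp [lastIdx, Word.rcons, hm, Word.empty]
    · simp [lastIdx, Word.rcons, hm, Word.empty, List.getLast?_cons]

theorem lastIdx_of_smul [DecidableEq ι] [∀ i, DecidableEq (M i)] {a : M j} {w : Word M}
    (h : j = i → w ≠ Word.empty ∧ of a • w ≠ Word.empty) :
    lastIdx (of a • w) = some i ↔ lastIdx w = some i := by
  obtain ⟨p, rfl⟩ : ∃ p : Word.Pair M j, Word.rcons p = w := (Word.equivPair j).symm.surjective w
  have hsmul : of a • Word.rcons p = Word.rcons { p with head := a * p.head } := by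
    simp only [Word.rcons_eq_smul, smul_smul, map_mul]
  rw [hsmul] at h ⊢
  rw [lastIdx_rcons fun hj => (h hj).1, lastIdx_rcons fun hj => (h hj).2]

end Word

namespace IsFreeFactorization

variable {G : Type*} [Group G] {A : ι → Subgroup G} (h : IsFreeFactorization ⊤ A) {g a : G}

open Classical in
/-- The reduced word that represents an element of a group with a free factorization. -/
noncomputable def normalForm : G ≃ Monoid.CoprodI.Word fun i => A i :=
  h.mulEquiv.symm.toEquiv.trans Monoid.CoprodI.Word.equiv

theorem normalForm_one : h.normalForm 1 = Monoid.CoprodI.Word.empty := by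
  simp [normalForm, Monoid.CoprodI.Word.equiv]

open Classical in
theorem normalForm_mul (ha : a ∈ A i) (g : G) :
    h.normalForm (a * g) = Monoid.CoprodI.of (M := fun i => A i) ⟨a, ha⟩ • h.normalForm g := by
  have hof : h.mulEquiv.symm a = Monoid.CoprodI.of (M := fun i => A i) ⟨a, ha⟩ := by
    rw [MulEquiv.symm_apply_eq, h.mulEquiv_of]
  simp [normalForm, Monoid.CoprodI.Word.equiv, hof, mul_smul]

/-- The elements whose normal form with respect to a free factorization begins with a letter of
the factor `A i`. It is encoded by the last letter of the inverse, because Mathlib's action on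
reduced words is by multiplication on the left. -/
def beginningIn (i : ι) : Set G :=
  {g | lastIdx (h.normalForm g⁻¹) = some i}

theorem one_notMem_beginningIn : 1 ∉ h.beginningIn i := by
  simp [beginningIn, normalForm_one, lastIdx, Monoid.CoprodI.Word.empty]

open Classical in
theorem mul_mem_beginningIn_iff (ha : a ∈ A j) (hg : j = i → g ≠ 1 ∧ g * a ≠ 1) :
    g * a ∈ h.beginningIn i ↔ g ∈ h.beginningIn i := by
  have hne {x : G} (hx : x ≠ 1) : h.normalForm x⁻¹ ≠ Monoid.CoprodI.Word.empty := by
    rwa [← h.normalForm_one, h.normalForm.injective.ne_iff, inv_ne_one]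
  have hmul := h.normalForm_mul (inv_mem ha) g⁻¹
  rw [← mul_inv_rev] at hmul
  simp only [beginningIn, Set.mem_ofPred_eq, hmul]
  exact lastIdx_of_smul fun hj => ⟨hne (hg hj).1, hmul ▸ hne (hg hj).2⟩

theorem mem_beginningIn (ha : a ∈ A i) (ha1 : a ≠ 1) : a ∈ h.beginningIn i := by
  classical
  let p : Monoid.CoprodI.Word.Pair (fun i => A i) i :=
    ⟨⟨a⁻¹, inv_mem ha⟩, Monoid.CoprodI.Word.empty,
      by simp [Monoid.CoprodI.Word.fstIdx, Monoid.CoprodI.Word.empty]⟩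
  have hp : h.normalForm a⁻¹ = Monoid.CoprodI.Word.rcons p := by
    rw [← mul_one a⁻¹, h.normalForm_mul (inv_mem ha), h.normalForm_one,
      Monoid.CoprodI.Word.rcons_eq_smul]
  rw [beginningIn, Set.mem_ofPred_eq, hp]
  refine (lastIdx_rcons (p := p) fun _ => ?_).mpr (Or.inl ⟨rfl, rfl⟩)
  rwa [← hp, ← h.normalForm_one, h.normalForm.injective.ne_iff, inv_ne_one]

theorem almostInvariant_beginningIn (i : ι) : AlmostInvariant G (h.beginningIn i) := by
  have key (y x : G) :
      {g : G | ¬ (g * x ∈ h.beginningIn i ↔ g * (x * y) ∈ h.beginningIn i)}.Finite := by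
    induction y using h.induction generalizing x with
    | one => simp
    | mem j a ha =>
      refine (Set.toFinite {x⁻¹, (x * a)⁻¹}).subset fun g hg => ?_
      by_contra hne
      simp only [Set.mem_insert_iff, Set.mem_singleton_iff, not_or, eq_inv_iff_mul_eq_one,
        ← mul_assoc] at hne
      rw [Set.mem_ofPred_eq, ← mul_assoc] at hg
      exact hg (h.mul_mem_beginningIn_iff ha fun _ => hne).symm
    | mul a b ha hb =>
      refine ((ha x).union (hb (x * a))).subset fun g hg => ?_
      by_contra hne
      simp only [Set.mem_union, Set.mem_ofPred_eq, not_or, not_not] at hne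
      exact hg (by rw [← mul_assoc x]; exact hne.1.trans hne.2)
  exact fun x z => by simpa using key (x⁻¹ * z) x

end IsFreeFactorization

end NormalForm

section EndsOfSubgroups

theorem AlmostInvariant.preimage {G X Y : Type*} [Group G] [MulAction G X] [MulAction G Y]
    {S : Set Y} (h : AlmostInvariant G S) {f : X → Y} (hf : ∀ (g : G) x, f (g • x) = g • f x) :
    AlmostInvariant G (f ⁻¹' S) := fun x y => by
  simpa only [Set.mem_preimage, hf] using h (f x) (f y)

variable {n : ℕ} {V : Type*} {H : Set (Vert n V)} {N : ℕ}

theorem StableFrom.mem_iff_of_isPrefix (h : StableFrom H N) {a b : FreeGroup (Fin n)}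
    (ha : N ≤ a.norm) (hab : a.toWord <+: b.toWord) (u : V) :
    (⟨a, u⟩ : Vert n V) ∈ H ↔ ⟨b, u⟩ ∈ H := by
  obtain ⟨L, hL⟩ := hab
  induction L using List.reverseRecOn generalizing b with
  | nil => rw [FreeGroup.toWord_inj.mp ((List.append_nil _).symm.trans hL)]
  | append_singleton L s ih =>
    have hred : FreeGroup.IsReduced (a.toWord ++ L ++ [s]) := by
      rw [List.append_assoc, hL]
      exact FreeGroup.isReduced_toWord
    have hword : a.toWord ++ L = (FreeGroup.mk (a.toWord ++ L)).toWord := by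
      rw [FreeGroup.toWord_mk, FreeGroup.IsReduced.reduce_eq (List.IsChain.left_of_append hred)]
    have hb : b = FreeGroup.mk (a.toWord ++ L) * ofLetter s := by
      rw [ofLetter, FreeGroup.mul_mk, List.append_assoc, hL, FreeGroup.mk_toWord]
    rw [ih hword, hb]
    refine h ?_ (norm_ofLetter s).le u u
    rw [FreeGroup.norm, ← hword, List.length_append]
    exact ha.trans (Nat.le_add_right _ _)

theorem AlmostInvariant.endsIn_of_mem_boundaryOf [Finite V]
    (h : AlmostInvariant (FreeGroup (Fin n)) H) {A : Subgroup (FreeGroup (Fin n))}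
    {ξ : Boundary n} (hξ : ξ ∈ boundaryOf A) {u : V}
    (hA : {a ∈ (A : Set (FreeGroup (Fin n))) | (⟨a, u⟩ : Vert n V) ∉ H}.Finite) : EndsIn H ξ := by
  obtain ⟨N, hN⟩ := h.exists_stableFrom
  obtain ⟨M, hM⟩ := (hA.image FreeGroup.norm).bddAbove
  obtain ⟨a, ha, hpre⟩ := hξ (N + (M + 1))
  rw [← toWord_rayVertex] at hpre
  rw [hN.endsIn_iff (Nat.le_add_right N (M + 1)) u,
    hN.mem_iff_of_isPrefix (by rw [norm_rayVertex]; omega) hpre]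
  by_contra hau
  have haM : a.norm ≤ M := hM ⟨a, ⟨ha, hau⟩, rfl⟩
  have hle : N + (M + 1) ≤ a.norm := (norm_rayVertex ξ _).ge.trans hpre.length_le
  omega

theorem endsIn_smul_iff {ξ : Boundary n} (g : FreeGroup (Fin n)) :
    EndsIn H (g • ξ) ↔ EndsIn (g⁻¹ • H) ξ :=
  ⟨fun h => by simpa using h.smul g⁻¹, fun h => by simpa using h.smul g⟩

section RightInvariant

variable [Finite V] [Nonempty V] {S : Set (FreeGroup (Fin n))} {A : Subgroup (FreeGroup (Fin n))}
  {c : ConjAct (FreeGroup (Fin n))} {ξ η : Boundary n}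

theorem endsIn_smul_of_mem_boundaryOf (hS : AlmostInvariant (FreeGroup (Fin n)) S)
    (hA : ∀ g, ∀ a ∈ A, g * a ∈ S ↔ g ∈ S) (hξ : ξ ∈ boundaryOf (c • A))
    {g : FreeGroup (Fin n)} (hg : g * ConjAct.ofConjAct c ∈ S) :
    EndsIn (Vert.base ⁻¹' S : Set (Vert n V)) (g • ξ) := by
  have hP : AlmostInvariant (FreeGroup (Fin n)) (Vert.base ⁻¹' S : Set (Vert n V)) :=
    hS.preimage fun _ _ => rfl
  rw [endsIn_smul_iff]
  refine (hP.smul g⁻¹).endsIn_of_mem_boundaryOf hξ (u := Classical.arbitrary V) ?_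
  refine ((hS 1 (ConjAct.ofConjAct c)).preimage (f := fun a => g * a)
    (mul_right_injective g).injOn).subset ?_
  rintro a ⟨⟨b, hb, rfl⟩, hab⟩
  rw [Set.mem_smul_set_iff_inv_smul_mem, inv_inv] at hab
  have hgb : g * (c • b) * ConjAct.ofConjAct c ∈ S := by
    rw [ConjAct.smul_def, ← mul_assoc, inv_mul_cancel_right, ← mul_assoc]
    exact (hA _ b hb).mpr hg
  refine fun hiff => hab ?_
  simpa using hiff.mpr hgb

theorem endsIn_smul_iff_of_mem_boundaryOf (hS : AlmostInvariant (FreeGroup (Fin n)) S)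
    (hA : ∀ g, ∀ a ∈ A, g * a ∈ S ↔ g ∈ S) (hξ : ξ ∈ boundaryOf (c • A))
    {g : FreeGroup (Fin n)} :
    EndsIn (Vert.base ⁻¹' S : Set (Vert n V)) (g • ξ) ↔ g * ConjAct.ofConjAct c ∈ S := by
  refine ⟨fun h => by_contra fun hg => ?_, endsIn_smul_of_mem_boundaryOf hS hA hξ⟩
  exact (AlmostInvariant.endsIn_compl_iff (hS.preimage fun _ _ => rfl)).mp
    (endsIn_smul_of_mem_boundaryOf hS.compl (fun g a ha => not_congr (hA g a ha)) hξ hg) h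

end RightInvariant

theorem exists_rayVertex_eq {g : FreeGroup (Fin n)} (hg : g ≠ 1) :
    ∃ ξ : Boundary n, rayVertex ξ g.norm = g := by
  suffices key : ∀ (L : List (Letter n)) (s : Letter n), FreeGroup.IsReduced (s :: L) →
      ∃ ξ : Boundary n, ξ.1 0 = s ∧ rayVertex ξ (L.length + 1) = FreeGroup.mk (s :: L) by
    obtain ⟨s, L, hL⟩ := List.exists_cons_of_ne_nil (mt FreeGroup.toWord_eq_nil_iff.mp hg)
    obtain ⟨ξ, -, hξ⟩ := key L s (hL ▸ FreeGroup.isReduced_toWord)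
    exact ⟨ξ, by rw [FreeGroup.norm, hL, List.length_cons, hξ, ← hL, FreeGroup.mk_toWord]⟩
  intro L
  induction L with
  | nil =>
    exact fun s _ => ⟨⟨fun _ => s, fun _ => s.inv_ne.symm⟩, rfl, rayVertex_one _⟩
  | cons t L ih =>
    intro s hL
    obtain ⟨hst, hL⟩ := FreeGroup.isReduced_cons_cons.mp hL
    obtain ⟨ξ, rfl, hξ⟩ := ih t hL
    have hpair : FreeGroup.IsReduced [s, ξ.1 0] := by simpa using hst
    have hs : ξ.1 0 ≠ s.inv := fun h =>
      Letter.isReduced_pair_iff.mp hpair (by rw [h, Letter.inv_inv])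
    refine ⟨ofLetter s • ξ, ofLetter_smul_apply_zero hs, ?_⟩
    have hsucc : rayVertex (ofLetter s • ξ) (L.length + 1 + 1) =
        ofLetter s * rayVertex ξ (L.length + 1) := by
      rw [rayVertex, List.ofFn_succ]
      simp only [Fin.val_succ, Fin.val_zero, ofLetter_smul_apply_zero hs,
        ofLetter_smul_apply_succ hs]
      rw [rayVertex, ofLetter, FreeGroup.mul_mk, List.singleton_append]
    rw [List.length_cons, hsucc, hξ, ofLetter, FreeGroup.mul_mk, List.singleton_append]

theorem AlmostInvariant.exists_endsIn [Finite V] [Nonempty V]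
    (h : AlmostInvariant (FreeGroup (Fin n)) H) {S : Set (FreeGroup (Fin n))} (hS : S.Infinite)
    (hSH : ∀ g ∈ S, ∀ u, (⟨g, u⟩ : Vert n V) ∈ H) : ∃ ξ, EndsIn H ξ := by
  obtain ⟨N, hN⟩ := h.exists_stableFrom
  obtain ⟨g, hg, hgN⟩ := hS.exists_notMem_finite (finite_norm_le N)
  rw [Set.mem_ofPred_eq, not_le] at hgN
  have hg1 : g ≠ 1 := by
    rintro rfl
    simp at hgN
  obtain ⟨ξ, hξ⟩ := exists_rayVertex_eq hg1
  refine ⟨ξ, (hN.endsIn_iff hgN.le (Classical.arbitrary V)).mpr ?_⟩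
  rw [hξ]
  exact hSH g hg _

end EndsOfSubgroups

section HalfSpacesAtVertex

variable {X : Type*} {Γ : SimpleGraph X} {v w r x : X} {A H : Set X}

theorem disjoint_halfSpace (hΓ : Γ.IsTree) (hw : Γ.Adj v w) (hr : Γ.Adj v r) (hne : w ≠ r) :
    Disjoint (halfSpace Γ v w) (halfSpace Γ v r) := by
  have hHw := isHalfSpace_halfSpace hΓ.isAcyclic hw
  have hHr := isHalfSpace_halfSpace hΓ.isAcyclic hr
  exact hHw.disjoint hΓ.connected.preconnected hw hr hHr hHr.notMem hHw.notMem
    fun he => hne (congrArg Prod.snd he)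

theorem halfSpace_subset (hΓ : Γ.IsTree) (hvw : Γ.Adj v w) (hwr : Γ.Adj w r) (hne : r ≠ v) :
    halfSpace Γ w r ⊆ halfSpace Γ v w := by
  rw [← Set.disjoint_compl_right_iff_subset, ← halfSpace_swap hΓ hvw]
  exact disjoint_halfSpace hΓ hwr hvw.symm hne

theorem exists_mem_halfSpace (hΓ : Γ.IsTree) (hvw : Γ.Adj v w) (hx : x ∈ halfSpace Γ v w)
    (hne : x ≠ w) : ∃ r, Γ.Adj w r ∧ r ≠ v ∧ x ∈ halfSpace Γ w r := by
  have hH := isHalfSpace_halfSpace hΓ.isAcyclic hvw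
  by_contra! hc
  -- the vertices violating the claim are closed under adjacency but do not include `v`
  refine hH.notMem (forall_of_forall_adj hΓ.connected.preconnected
    (p := fun y => y ∈ halfSpace Γ v w ∧ y ≠ w ∧ ∀ r, Γ.Adj w r → r ≠ v → y ∉ halfSpace Γ w r)
    ⟨hx, hne, hc⟩ (fun y z hyz hy => ?_) v).1
  obtain ⟨hyH, hyw, hy⟩ := hy
  refine ⟨by_contra fun hz => hyw (hH.eq_of_adj hyz.symm hz hyH).2, ?_, fun r hr hrv hz => ?_⟩
  · rintro rfl
    exact hy y hyz.symm (fun hyv => hH.notMem (hyv ▸ hyH))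
      (isHalfSpace_halfSpace hΓ.isAcyclic hyz.symm).mem
  · exact hyw ((isHalfSpace_halfSpace hΓ.isAcyclic hr).eq_of_adj hyz (hy r hr hrv) hz).1

namespace IsHalfSpace

theorem mem_of_connected (h : IsHalfSpace Γ v w H) (hA : (Γ.induce A).Connected) (hv : v ∈ A)
    (hx : x ∈ A) (hxH : x ∈ H) : w ∈ A := by
  by_contra hw
  refine forall_of_forall_adj hA.preconnected (x := (⟨v, hv⟩ : A)) (p := fun y => y.1 ∉ H)
    h.notMem (fun y z hyz hy hz => hw ?_) ⟨x, hx⟩ hxH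
  exact (h.eq_of_adj hyz hy hz).2 ▸ z.2

theorem mem_iff_of_forall_adj (hΓ : Γ.Preconnected) (h : IsHalfSpace Γ v w H) {P : Set X}
    (hP : ∀ ⦃y z⦄, y ∈ H → Γ.Adj y z → (y ∈ P ↔ z ∈ P)) (hx : x ∈ H) : x ∈ P ↔ w ∈ P := by
  by_contra hne
  refine h.notMem (forall_of_forall_adj hΓ (p := fun y => y ∈ H ∧ ¬ (y ∈ P ↔ w ∈ P)) ⟨hx, hne⟩
    (fun y z hyz hy => ⟨by_contra fun hz => hy.2 ?_, ?_⟩) v).1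
  · rw [(h.eq_of_adj hyz.symm hz hy.1).2]
  · rw [← hP hy.1 hyz]
    exact hy.2

end IsHalfSpace

end HalfSpacesAtVertex

section EndsConstantOn

variable {n : ℕ} {V : Type*} {T : LabelledTree n V} {z : Vert n V} {d : Letter n × V}
  {A P : Set (Vert n V)}

theorem LabelledTree.exists_endsIn_halfSpaceAt [Finite V] {ξ : Boundary n}
    (hd : d ∈ T.directions z.label) (hξ : EndsIn (T.halfSpaceAt z d) ξ) :
    ∃ e ∈ T.directions d.2, e ≠ (d.1.inv, z.label) ∧
      EndsIn (T.halfSpaceAt (z.next d) e) ξ := by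
  have := T.nonempty
  by_contra! hc
  have hout : ∀ e : Letter n × V, ∀ᶠ i in atTop, e ∈ T.directions d.2 → e ≠ (d.1.inv, z.label) →
      ∀ u, (⟨rayVertex ξ i, u⟩ : Vert n V) ∉ T.halfSpaceAt (z.next d) e := by
    intro e
    by_cases he : e ∈ T.directions d.2 ∧ e ≠ (d.1.inv, z.label)
    · have hcompl : EndsIn (T.halfSpaceAt (z.next d) e)ᶜ ξ :=
        (almostInvariant_halfSpaceAt (z := z.next d) he.1).endsIn_compl_iff.mpr (hc e he.1 he.2)
      exact Eventually.mono hcompl fun i hi _ _ => hi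
    · exact Eventually.of_forall fun i he₁ he₂ => (he ⟨he₁, he₂⟩).elim
  let u := Classical.arbitrary V
  obtain ⟨i, hi, hmem, hnorm⟩ := ((eventually_all.mpr hout).and
    (hξ.and (eventually_gt_atTop (z.next d).base.norm))).exists
  have hne : (⟨rayVertex ξ i, u⟩ : Vert n V) ≠ z.next d := by
    intro he
    rw [← he, norm_rayVertex] at hnorm
    exact lt_irrefl i hnorm
  obtain ⟨r, hr, hrz, hur⟩ :=
    exists_mem_halfSpace T.isTree (LabelledGraph.cover_adj_next.mpr hd) (hmem u) hne
  obtain ⟨e, he, rfl⟩ := LabelledGraph.exists_eq_next hr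
  refine hi e he (fun heq => hrz ?_) u hur
  rw [heq, z.next_next_inv]

theorem AlmostInvariant.finite_exists_adj [Finite V] (hP : AlmostInvariant (FreeGroup (Fin n)) P)
    (Δ : LabelledGraph n V) : {y | ∃ z, Δ.cover.Adj y z ∧ ¬ (y ∈ P ↔ z ∈ P)}.Finite := by
  have hfin : (⋃ q : V × Letter n × V, (fun g : FreeGroup (Fin n) => g • (⟨1, q.1⟩ : Vert n V)) ''
      {g | ¬ (g • (⟨1, q.1⟩ : Vert n V) ∈ P ↔ g • (⟨1, q.1⟩ : Vert n V).next q.2 ∈ P)}).Finite :=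
    Set.finite_iUnion fun q => (hP _ _).image _
  refine hfin.subset ?_
  rintro y ⟨z, hyz, hP⟩
  obtain ⟨d, -, rfl⟩ := LabelledGraph.exists_eq_next hyz
  refine Set.mem_iUnion.mpr ⟨(y.label, d), y.base, ?_, y.smul_one_label⟩
  rwa [Set.mem_ofPred_eq, Vert.smul_next, y.smul_one_label]

/-- The ends of `H` all belong to `P`, or none of them does. -/
def EndsConstantOn (P H : Set (Vert n V)) : Prop :=
  ∀ ξ ξ' : Boundary n, EndsIn H ξ → EndsIn H ξ' → (EndsIn P ξ ↔ EndsIn P ξ')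

theorem endsIn_iff_mem_of_forall {H : Set (Vert n V)} (h : ∀ y ∈ H, (y ∈ P ↔ z ∈ P))
    [Nonempty V] {ξ : Boundary n} (hξ : EndsIn H ξ) : EndsIn P ξ ↔ z ∈ P := by
  refine ⟨fun hP => ?_, fun hz => hξ.mono fun y hy => (h y hy).mpr hz⟩
  obtain ⟨i, hiH, hiP⟩ := (hξ.and hP).exists
  exact (h _ (hiH (Classical.arbitrary V))).mp (hiP _)

theorem LabelledTree.endsConstantOn_of_disjoint (hd : d ∈ T.directions z.label)
    (hA : ∀ ⦃y y'⦄, T.cover.Adj y y' → y ∉ A → (y ∈ P ↔ y' ∈ P))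
    (hdisj : Disjoint (T.halfSpaceAt z d) A) : EndsConstantOn P (T.halfSpaceAt z d) := by
  have := T.nonempty
  have hconst : ∀ y ∈ T.halfSpaceAt z d, (y ∈ P ↔ z.next d ∈ P) := fun y =>
    (isHalfSpace_halfSpaceAt hd).mem_iff_of_forall_adj T.isTree.connected.preconnected
      fun _ _ hy hadj => hA hadj (hdisj.notMem_of_mem_left hy)
  exact fun ξ ξ' hξ hξ' =>
    (endsIn_iff_mem_of_forall hconst hξ).trans (endsIn_iff_mem_of_forall hconst hξ').symm

end EndsConstantOn

section Rigidity

variable {n : ℕ} {B : Set (Line n)} {p : Boundary n × Boundary n}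

namespace Resolution

/-- Each turn of a lift of a line of `B` is also taken by a pair of ends that no translate of `P`
separates. -/
def TurnsUnseparated (R : Resolution n B) (P : Set (Vert n R.V)) : Prop :=
  ∀ p ∈ lifts B, Pointed p → ∃ q : Boundary n × Boundary n,
    (∀ g : FreeGroup (Fin n), EndsIn P (g • q.1) ↔ EndsIn P (g • q.2)) ∧
      EndsIn (R.tree.halfSpaceAt ⟨1, R.map.lam p⟩ (R.map.dir p)) q.1 ∧
      EndsIn (R.tree.halfSpaceAt ⟨1, R.map.lam p⟩ (R.map.dir p.swap)) q.2

variable {R : Resolution n B} {P : Set (Vert n R.V)} {z : Vert n R.V} {d : Letter n × R.V}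

theorem TurnsUnseparated.exists_endsIn_halfSpaceAt (h : R.TurnsUnseparated P) (hp : p ∈ lifts B)
    (hpp : Pointed p) (hz : R.map.lam p = z.label) :
    ∃ ξ η, (EndsIn P ξ ↔ EndsIn P η) ∧ EndsIn (R.tree.halfSpaceAt z (R.map.dir p)) ξ ∧
      EndsIn (R.tree.halfSpaceAt z (R.map.dir p.swap)) η := by
  obtain ⟨g, v⟩ := z
  obtain rfl : R.map.lam p = v := hz
  obtain ⟨q, hq, hq₁, hq₂⟩ := h p hp hpp
  have htranslate {d} (hd : d ∈ R.tree.directions (R.map.lam p)) :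
      R.tree.halfSpaceAt ⟨g, R.map.lam p⟩ d = g • R.tree.halfSpaceAt ⟨1, R.map.lam p⟩ d := by
    rw [← LabelledTree.halfSpaceAt_smul (z := ⟨1, R.map.lam p⟩) hd, Vert.smul_mk, mul_one]
  refine ⟨g • q.1, g • q.2, hq g, ?_, ?_⟩
  · rw [htranslate (R.map.dir_mem hp hpp)]
    exact hq₁.smul g
  · rw [htranslate (R.map.dir_swap_mem hp hpp)]
    exact hq₂.smul g

namespace NoCut

theorem endsConstantOn_of_forall (hR : R.NoCut) (hturn : R.TurnsUnseparated P)
    (hd : d ∈ R.tree.directions z.label)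
    (h : ∀ e ∈ R.tree.directions d.2, e ≠ (d.1.inv, z.label) →
      EndsConstantOn P (R.tree.halfSpaceAt (z.next d) e)) :
    EndsConstantOn P (R.tree.halfSpaceAt z d) := by
  suffices key : ∀ ξ ξ', EndsIn (R.tree.halfSpaceAt z d) ξ → EndsIn (R.tree.halfSpaceAt z d) ξ' →
      EndsIn P ξ → EndsIn P ξ' from
    fun ξ ξ' hξ hξ' => ⟨key ξ ξ' hξ hξ', key ξ' ξ hξ' hξ⟩
  intro ξ ξ' hξ hξ' hPξ
  by_contra hPξ'
  obtain ⟨e, he, hed, heξ⟩ := LabelledTree.exists_endsIn_halfSpaceAt hd hξ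
  obtain ⟨e', he', hed', heξ'⟩ := LabelledTree.exists_endsIn_halfSpaceAt hd hξ'
  let X : Set (Letter n × R.V) := {a | a ∈ R.tree.directions d.2 ∧ a ≠ (d.1.inv, z.label) ∧
    ∃ ζ, EndsIn (R.tree.halfSpaceAt (z.next d) a) ζ ∧ EndsIn P ζ}
  have he'X : e' ∉ X := fun ⟨_, _, ζ, hζ, hPζ⟩ => hPξ' ((h e' he' hed' ζ ξ' hζ heξ').mp hPζ)
  refine hR d.2 (d.1.inv, z.label) (R.tree.symm hd) X (fun hx => hx.2.1 rfl)
    ⟨e, ⟨he, hed, ξ, heξ, hPξ⟩, he⟩ ⟨e', he', not_or_intro hed' he'X⟩ ?_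
  rintro p hp hpp hv ⟨hdir, hne, ζ, hζ, hPζ⟩
  obtain ⟨η, η', hη, hηp, hηp'⟩ :=
    hturn.exists_endsIn_halfSpaceAt (z := z.next d) hp hpp hv
  refine or_iff_not_imp_right.mpr fun hswap => ⟨hv ▸ R.map.dir_swap_mem hp hpp, hswap, η', hηp', ?_⟩
  exact hη.mp ((h _ hdir hne ζ η hζ hηp).mp hPζ)

theorem endsConstantOn_of_connected (hR : R.NoCut) (hturn : R.TurnsUnseparated P)
    {A : Set (Vert n R.V)} (hfin : A.Finite) (hconn : (R.tree.cover.induce A).Connected)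
    (hA : ∀ ⦃y y'⦄, R.tree.cover.Adj y y' → y ∉ A → (y ∈ P ↔ y' ∈ P)) (hz : z ∈ A)
    (hd : d ∈ R.tree.directions z.label) : EndsConstantOn P (R.tree.halfSpaceAt z d) := by
  induction hk : (A ∩ R.tree.halfSpaceAt z d).ncard using Nat.strong_induction_on
    generalizing z d with
  | _ k ih =>
  have hH := LabelledTree.isHalfSpace_halfSpaceAt hd
  by_cases hz' : z.next d ∈ A
  · refine hR.endsConstantOn_of_forall hturn hd fun e he hed => ih _ ?_ hz' he rfl
    have hsub : R.tree.halfSpaceAt (z.next d) e ⊆ R.tree.halfSpaceAt z d :=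
      halfSpace_subset R.tree.isTree (LabelledGraph.cover_adj_next.mpr hd)
        (LabelledGraph.cover_adj_next.mpr he) fun hez =>
          hed ((z.next d).next_injective (hez.trans (z.next_next_inv d).symm))
    rw [← hk]
    refine Set.ncard_lt_ncard ?_ (hfin.inter_of_left _)
    exact (Set.ssubset_iff_of_subset (Set.inter_subset_inter_right A hsub)).mpr ⟨z.next d,
      ⟨hz', hH.mem⟩, fun h => (LabelledTree.isHalfSpace_halfSpaceAt he).notMem h.2⟩
  · exact LabelledTree.endsConstantOn_of_disjoint hd hA <|
      Set.disjoint_left.mpr fun y hy hyA => hz' (hH.mem_of_connected hconn hz hyA hy)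

theorem endsConstantOn_halfSpaceAt (hR : R.NoCut) (hturn : R.TurnsUnseparated P)
    (hP : AlmostInvariant (FreeGroup (Fin n)) P) (hd : d ∈ R.tree.directions z.label) :
    EndsConstantOn P (R.tree.halfSpaceAt z d) := by
  have hfin := (hP.finite_exists_adj R.tree.toLabelledGraph).insert z
  obtain ⟨A, hsub, hconn⟩ := SimpleGraph.extend_finset_to_connected
    R.tree.isTree.connected.preconnected (t := hfin.toFinset) ⟨z, by simp⟩
  have hmem : ∀ y ∈ insert z {y | ∃ y', R.tree.cover.Adj y y' ∧ ¬ (y ∈ P ↔ y' ∈ P)}, y ∈ A :=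
    fun y hy => hsub (hfin.mem_toFinset.mpr hy)
  refine hR.endsConstantOn_of_connected hturn A.finite_toSet hconn (fun y y' hadj hy => ?_)
    (hmem z (Set.mem_insert z _)) hd
  exact by_contra fun hne => hy (hmem y (Set.mem_insert_of_mem z ⟨y', hadj, hne⟩))

theorem endsIn_iff (hR : R.NoCut) (hturn : R.TurnsUnseparated P)
    (hP : AlmostInvariant (FreeGroup (Fin n)) P) (ξ ξ' : Boundary n) :
    EndsIn P ξ ↔ EndsIn P ξ' := by
  obtain ⟨p, hp, hpp, -⟩ := R.visited (Classical.arbitrary R.V)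
  let z : Vert n R.V := ⟨1, R.map.lam p⟩
  have hd : R.map.dir p ∈ R.tree.directions z.label := R.map.dir_mem hp hpp
  have hd' : R.map.dir p.swap ∈ R.tree.directions z.label := R.map.dir_swap_mem hp hpp
  obtain ⟨η, η', hη, hηp, hηp'⟩ := hturn.exists_endsIn_halfSpaceAt (z := z) hp hpp rfl
  have hdisj : Disjoint (R.tree.halfSpaceAt z (R.map.dir p.swap))
      (R.tree.halfSpaceAt z (R.map.dir p)) :=
    disjoint_halfSpace R.tree.isTree (LabelledGraph.cover_adj_next.mpr hd')
      (LabelledGraph.cover_adj_next.mpr hd) fun he =>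
        R.map.dir_ne_dir_swap hpp (z.next_injective he).symm
  have hconst := hR.endsConstantOn_halfSpaceAt hturn hP hd
  have hconst' : EndsConstantOn P (R.tree.halfSpaceAt z (R.map.dir p))ᶜ := by
    rw [← LabelledTree.halfSpaceAt_next hd]
    exact hR.endsConstantOn_halfSpaceAt hturn hP (R.tree.symm hd)
  have hall : ∀ ζ, EndsIn P ζ ↔ EndsIn P η := fun ζ => by
    by_cases hζ : EndsIn (R.tree.halfSpaceAt z (R.map.dir p)) ζ
    · exact hconst ζ η hζ hηp
    · rw [← (LabelledTree.almostInvariant_halfSpaceAt hd).endsIn_compl_iff] at hζ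
      exact (hconst' ζ η' hζ (hηp'.mono hdisj.subset_compl_right)).trans hη.symm
  exact (hall ξ).trans (hall ξ').symm

end NoCut

end Resolution

end Rigidity

section Neighbourhoods

variable {n : ℕ}

theorem line_mk_eq_iff {p q : EndpointPair n} :
    Line.mk p = Line.mk q ↔ ∃ g : FreeGroup (Fin n), g • p.1 = q.1 ∨ g • p.1 = q.1.swap :=
  Quotient.eq (r := lineSetoid n)

theorem isOpenMap_line_mk : IsOpenMap (Line.mk : EndpointPair n → Line n) := by
  rintro _ ⟨W, hW, rfl⟩
  have hpreimage : Line.mk ⁻¹' (Line.mk '' (Subtype.val ⁻¹' W : Set (EndpointPair n))) =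
      ⋃ g : FreeGroup (Fin n), (fun q : EndpointPair n => g • q.1) ⁻¹'
        (W ∪ Prod.swap ⁻¹' W) := by
    ext q
    simp only [Set.mem_preimage, Set.mem_image, Set.mem_iUnion, Set.mem_union]
    constructor
    · rintro ⟨p, hp, h⟩
      obtain ⟨g, hg | hg⟩ := line_mk_eq_iff.mp h.symm
      · exact ⟨g, Or.inl (hg ▸ hp)⟩
      · exact ⟨g, Or.inr (by rwa [hg, Prod.swap_swap])⟩
    · have hne (g : FreeGroup (Fin n)) : (g • q.1).1 ≠ (g • q.1).2 :=
        fun h => q.2 (smul_left_cancel g h)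
      rintro ⟨g, hg | hg⟩
      · exact ⟨⟨g • q.1, hne g⟩, hg, line_mk_smul g q.2 _⟩
      · exact ⟨⟨(g • q.1).swap, (hne g).symm⟩, hg,
          (line_mk_swap (hne g) _).trans (line_mk_smul g q.2 _)⟩
  have hopen : IsOpen (Line.mk ⁻¹' (Line.mk '' (Subtype.val ⁻¹' W : Set (EndpointPair n)))) := by
    rw [hpreimage]
    exact isOpen_iUnion fun g => (hW.union (hW.preimage continuous_swap)).preimage
      (continuous_subtype_val.const_smul g)
  exact hopen

variable {B : Set (Line n)} (R : Resolution n B) {b : Line n}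

namespace Resolution

/-- The lines that take every turn taken by `b`, in the sense that they have a lift with ends in
the same two half-spaces. -/
def turnNhd (b : Line n) : Set (Line n) :=
  {ℓ | ∀ τ : R.V × (Letter n × R.V) × (Letter n × R.V),
    (∃ p ∈ lifts {b}, Pointed p ∧ (R.map.lam p, R.map.dir p, R.map.dir p.swap) = τ) →
    ∃ q : EndpointPair n, Line.mk q = ℓ ∧
      EndsIn (R.tree.halfSpaceAt ⟨1, τ.1⟩ τ.2.1) q.1.1 ∧
      EndsIn (R.tree.halfSpaceAt ⟨1, τ.1⟩ τ.2.2) q.1.2}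

theorem turnNhd_mem_nhds (hb : b ∈ B) : R.turnNhd b ∈ 𝓝 b := by
  refine eventually_all.mpr fun τ => ?_
  by_cases hτ : ∃ p ∈ lifts {b}, Pointed p ∧ (R.map.lam p, R.map.dir p, R.map.dir p.swap) = τ
  · obtain ⟨p, ⟨hne, rfl⟩, hpp, rfl⟩ := hτ
    have hp : p ∈ lifts B := ⟨hne, hb⟩
    obtain ⟨N, hN⟩ := (LabelledTree.almostInvariant_halfSpaceAt (z := ⟨1, R.map.lam p⟩)
      (R.map.dir_mem hp hpp)).exists_endsIn_congr
    obtain ⟨N', hN'⟩ := (LabelledTree.almostInvariant_halfSpaceAt (z := ⟨1, R.map.lam p⟩)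
      (R.map.dir_swap_mem hp hpp)).exists_endsIn_congr
    have hopen : IsOpen {q : EndpointPair n | (∀ i < N, q.1.1.1 i = p.1.1 i) ∧
        ∀ i < N', q.1.2.1 i = p.2.1 i} :=
      ((isOpen_cylinder p.1 N).preimage (continuous_fst.comp continuous_subtype_val)).inter
        ((isOpen_cylinder p.2 N').preimage (continuous_snd.comp continuous_subtype_val))
    filter_upwards [(isOpenMap_line_mk _ hopen).mem_nhds
      ⟨⟨p, hne⟩, ⟨fun _ _ => rfl, fun _ _ => rfl⟩, rfl⟩]
    rintro _ ⟨q, ⟨hq, hq'⟩, rfl⟩ -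
    exact ⟨q, rfl, (hN p.1 q.1.1 hq).mpr (R.map.endsIn_halfSpaceAt hp hpp),
      (hN' p.2 q.1.2 hq').mpr (R.map.endsIn_halfSpaceAt_swap hp hpp)⟩
  · exact Eventually.of_forall fun ℓ h => (hτ h).elim

end Resolution

end Neighbourhoods

section CarriedLines

variable {n : ℕ}

theorem notMem_boundaryOf_bot (ξ : Boundary n) : ξ ∉ boundaryOf ⊥ := by
  intro h
  obtain ⟨a, ha, hpre⟩ := h 1
  rw [Subgroup.mem_bot.mp ha, FreeGroup.toWord_one] at hpre
  simpa using hpre.length_le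

theorem not_carries_conjClass_bot (ℓ : Line n) : ¬ Carries {conjClass ⊥} ℓ := by
  rintro ⟨A, hA, p, -, hp, -⟩
  obtain ⟨c, rfl⟩ := conjClass_eq_iff.mp hA
  rw [Subgroup.smul_bot] at hp
  exact notMem_boundaryOf_bot _ hp

theorem Carries.endsIn_iff {V : Type*} [Finite V] [Nonempty V] {S : Set (FreeGroup (Fin n))}
    {A : Subgroup (FreeGroup (Fin n))} {q : EndpointPair n}
    (h : Carries {conjClass A} (Line.mk q)) (hS : AlmostInvariant (FreeGroup (Fin n)) S)
    (hA : ∀ g, ∀ a ∈ A, g * a ∈ S ↔ g ∈ S) (g : FreeGroup (Fin n)) :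
    EndsIn (Vert.base ⁻¹' S : Set (Vert n V)) (g • q.1.1) ↔
      EndsIn (Vert.base ⁻¹' S : Set (Vert n V)) (g • q.1.2) := by
  obtain ⟨A', hA', r, hr, hr₁, hr₂⟩ := h
  obtain ⟨c, rfl⟩ := conjClass_eq_iff.mp hA'
  have hr' : ∀ k : FreeGroup (Fin n), EndsIn (Vert.base ⁻¹' S : Set (Vert n V)) (k • r.1.1) ↔
      EndsIn (Vert.base ⁻¹' S : Set (Vert n V)) (k • r.1.2) := fun k =>
    (endsIn_smul_iff_of_mem_boundaryOf hS hA hr₁).trans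
      (endsIn_smul_iff_of_mem_boundaryOf hS hA hr₂).symm
  obtain ⟨k, hk | hk⟩ := line_mk_eq_iff.mp hr
  · rw [← hk, Prod.smul_fst, Prod.smul_snd, smul_smul, smul_smul]
    exact hr' (g * k)
  · rw [← Prod.swap_swap q.1, ← hk, Prod.fst_swap, Prod.snd_swap, Prod.smul_fst, Prod.smul_snd,
      smul_smul, smul_smul]
    exact (hr' (g * k)).symm

theorem IsFreeFactorization.right_ne_bot {G : Type*} [Group G] {H A C : Subgroup G}
    (h : IsFreeFactorization H ![A, C]) (hA : A ≠ H) : C ≠ ⊥ := by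
  rintro rfl
  refine hA ?_
  rw [← h.2, Monoid.CoprodI.range_eq_iSup]
  simp only [Subgroup.range_subtype]
  exact le_antisymm (le_iSup ![A, ⊥] 0) (iSup_le (Fin.forall_fin_two.mpr ⟨le_rfl, bot_le⟩))

theorem Resolution.NoCut.exists_forall_not_carries {B : Set (Line n)} {R : Resolution n B}
    (hR : R.NoCut) {F C : Subgroup (FreeGroup (Fin n))} (h : IsFreeFactorization ⊤ ![F, C])
    (hF : F ≠ ⊥) (hC : C ≠ ⊥) :
    ∃ b ∈ B, ∀ ℓ ∈ R.turnNhd b, ¬ Carries {conjClass F} ℓ := by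
  by_contra! hcarried
  have hS := h.almostInvariant_beginningIn 1
  have hFS : ∀ g, ∀ a ∈ F, g * a ∈ h.beginningIn 1 ↔ g ∈ h.beginningIn 1 := fun g a ha =>
    h.mul_mem_beginningIn_iff (j := 0) ha (by simp)
  have hturn : R.TurnsUnseparated (Vert.base ⁻¹' h.beginningIn 1) := by
    rintro p ⟨hne, hb⟩ hpp
    obtain ⟨ℓ, hℓ, hcarry⟩ := hcarried _ hb
    obtain ⟨q, rfl, hq, hq'⟩ := hℓ _ ⟨p, ⟨hne, rfl⟩, hpp, rfl⟩
    exact ⟨q.1, hcarry.endsIn_iff hS hFS, hq, hq'⟩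
  have hP : AlmostInvariant (FreeGroup (Fin n))
      (Vert.base ⁻¹' h.beginningIn 1 : Set (Vert n R.V)) := hS.preimage fun _ _ => rfl
  obtain ⟨ξ, hξ⟩ := hP.exists_endsIn (S := (C : Set (FreeGroup (Fin n))) \ {1})
    ((Set.infinite_coe_iff.mp (infinite_of_ne_bot hC)).sdiff (Set.finite_singleton 1))
    fun g hg _ => h.mem_beginningIn (i := 1) hg.1 hg.2
  obtain ⟨ξ', hξ'⟩ := hP.compl.exists_endsIn (S := (F : Set (FreeGroup (Fin n))))
    (Set.infinite_coe_iff.mp (infinite_of_ne_bot hF)) fun g hg _ hmem =>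
      h.one_notMem_beginningIn ((hFS 1 g hg).mp (by rwa [one_mul]))
  exact hP.endsIn_compl_iff.mp hξ' ((hR.endsIn_iff hturn hP ξ ξ').mp hξ)

end CarriedLines

end FreeLines

theorem mainTheorem9 (n : ℕ) (hn : 2 ≤ n) (B₁ B₂ : Set (FreeLines.Line n))
    (hB₁ : FreeLines.IsFilling B₁) (hB₂ : FreeLines.IsFilling B₂)
    (hdisj : closure B₁ ∩ closure B₂ = ∅) :
    ∃ U : FreeLines.Line n → Set (FreeLines.Line n),
      (∀ b ∈ B₁ ∪ B₂, U b ∈ nhds b) ∧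
      ∀ F : Subgroup (FreeGroup (Fin n)), FreeLines.IsFreeFactor F ⊤ → F ≠ ⊤ →
        ∃ b ∈ B₁ ∪ B₂, ∀ ℓ ∈ U b, ¬ FreeLines.Carries {FreeLines.conjClass F} ℓ := by
  obtain ⟨R, hR⟩ := FreeLines.exists_noCut hn hB₁ hB₂ hdisj
  refine ⟨R.turnNhd, fun b hb => R.turnNhd_mem_nhds hb, fun F ⟨C, hFC⟩ hF => ?_⟩
  rcases eq_or_ne F ⊥ with rfl | hF_bot
  · obtain ⟨b, hb⟩ := hB₁.nonempty
    exact ⟨b, Or.inl hb, fun ℓ _ => FreeLines.not_carries_conjClass_bot ℓ⟩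
  · exact hR.exists_forall_not_carries hFC hF_bot (hFC.right_ne_bot hF)
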